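/- Let $k$ be a field, $n\ge 0$ and $J\subset\{2,\dots,n\}$. Put $\mathfrak o(e_i)=-1$ if $i\in J$ and $\mathfrak o(e_i)=1$ otherwise. Let $\Gamma_J$ be the quiver with vertices $v_1,\dots,v_n$ and one arrow $e_i$ between $v_{i-1}$ and $v_i$ for each $2\le i\le n$, directed towards $v_i$ if $\mathfrak o(e_i)=1$ and towards $v_{i-1}$ if $\mathfrak o(e_i)=-1$. Let $A=\mathcal P(\Gamma_J)$ be its path algebra over $k$, where the product $pq$ of two paths is the path "first $q$, then $p$" (zero if they cannot be composed), and let $\mathcal D$ be the bounded derived category of finitely generated right $A$-modules. For $1\le i\le n$ let $P_i=e_{v_i}A$ be the projective right module spanned by all paths with target $v_i$; an arrow from $v_a$ to $v_b$ gives a map $P_a\to P_b$. Set $$p_J(j)=\frac{j-1}{2}-\frac12\sum_{i=1}^{j-1}\mathfrak o(e_{i+1})=\#\bigl(J\cap\{2,\dots,j\}\bigr),\qquad 1\le j\le n.$$ Use homological grading for complexes, so that $M[p]$ is the module $M$ placed in homological degree $p$. Define $\mathbf E_J=\langle E_1,\dots,E_n\rangle$ by $$E_i=\operatorname{Cone}\bigl(P_{i+1}\xrightarrow{\,e_{i+1}\,}P_i\bigr)[p_J(i)]\quad\text{if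 } i+1\in J,\qquad E_i=P_i[p_J(i)]\quad\text{otherwise;}$$ in the first case $E_i$ is the complex $0\leftarrow P_i\leftarrow P_{i+1}\leftarrow 0$ with $P_i$ in degree $p_J(i)$ and $P_{i+1}$ in degree $p_J(i+1)=p_J(i)+1$. Let $\mathcal D^{\ge 0}_J\subset\mathcal D$ be the full subcategory of all $C$ such that $H_m(\operatorname{Hom}(P_i,C))=0$ for all $1\le i\le n$ and all $m<p_J(i)$, and let $\mathcal D^{\le 0}_J$ be the full subcategory of all $C$ such that $\operatorname{Hom}_{\mathcal D}(X[1],C)=0$ for all $X\in\mathcal D^{\ge 0}_J$. Then: 1. $\mathbf E_J$ is a complete, strong exceptional collection in $\mathcal D$: one has $\operatorname{Hom}(E_i,E_i)=k\cdot\mathrm{id}$ with $\mathrm{id}_{E_i}\ne0$; $\operatorname{Hom}(E_j,E_i[m])=0$ for $i<j$ and all $m$; $\operatorname{Hom}(E_i,E_j[m])=0$ for all $i,j$ and all $m\ne 0$; and $\mathcal D$ is the only strictly full triangulated subcategory of $\mathcal D$ that contains all $E_i$. 2. $(\mathcal D^{\ge 0}_J,\mathcal D^{\le 0}_J)$ is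 a t-structure on $\mathcal D$ (in homological grading: $\mathcal D^{\ge0}_J$ is the half closed under $[1]$), and all $E_i$ lie in its heart $\mathcal D^{\ge 0}_J\cap\mathcal D^{\le 0}_J$. This heart is equivalent to the category of finitely generated right modules over the Yoneda algebra $$R_{\mathbf E_J}=\operatorname{Ext}^*\Bigl(\bigoplus_{i=1}^nE_i,\bigoplus_{i=1}^nE_i\Bigr)=\bigoplus_{m\in\mathbb Z}\operatorname{Hom}\Bigl(\bigoplus_{i=1}^nE_i,\bigoplus_{i=1}^nE_i[m]\Bigr),$$ in which the product $fg$ is "first $g$, then $f$". -/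

import Mathlib

open CategoryTheory Limits Triangulated
open scoped ZeroObject DirectSum

universe w v u

/-! ### Path algebras -/

/-- The path algebra of a quiver `V` over `k`: the `k`-vector space on all paths of `V`. -/
def PathAlgebra (k : Type u) (V : Type) [Field k] [Quiver.{0} V] : Type u :=
  (Σ a b : V, Quiver.Path a b) →₀ k

namespace PathAlgebra

noncomputable section

variable (k : Type u) {V : Type} [Field k] [Quiver.{0} V]

instance : AddCommGroup (PathAlgebra k V) :=
  inferInstanceAs (AddCommGroup ((Σ a b : V, Quiver.Path a b) →₀ k))

instance : Module k (PathAlgebra k V) :=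
  inferInstanceAs (Module k ((Σ a b : V, Quiver.Path a b) →₀ k))

/-- A path, as an element of the path algebra. -/
def ofPath {a b : V} (p : Quiver.Path a b) : PathAlgebra k V :=
  Finsupp.single ⟨a, b, p⟩ 1

/-- The idempotent `e_v` given by the trivial path at the vertex `v`. -/
def vertex (v : V) : PathAlgebra k V := ofPath k (Quiver.Path.nil : Quiver.Path v v)

/-- The element of the path algebra given by an arrow. -/
def arrow {a b : V} (f : a ⟶ b) : PathAlgebra k V := ofPath k f.toPath

/-- The product `p * q` of two paths is the path "first `q`, then `p`" if `q` ends where `p`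
starts, and it is zero otherwise. -/
def pathMul [DecidableEq V] (p q : Σ a b : V, Quiver.Path a b) : PathAlgebra k V :=
  if h : q.2.1 = p.1 then ofPath k ((q.2.2.cast rfl h).comp p.2.2) else 0

/-- The linear map given by its values on the paths. -/
def lift {M : Type*} [AddCommGroup M] [Module k M] (φ : (Σ a b : V, Quiver.Path a b) → M) :
    PathAlgebra k V →ₗ[k] M :=
  Finsupp.linearCombination k φ

lemma lift_ofPath {M : Type*} [AddCommGroup M] [Module k M]
    (φ : (Σ a b : V, Quiver.Path a b) → M) {a b : V} (p : Quiver.Path a b) :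
    lift k φ (ofPath k p) = φ ⟨a, b, p⟩ :=
  (Finsupp.linearCombination_single k (1 : k) (⟨a, b, p⟩ : Σ a b : V, Quiver.Path a b)).trans
    (one_smul k _)

/-- The bilinear extension of the product of paths. -/
def mulHom [DecidableEq V] :
    PathAlgebra k V →ₗ[k] PathAlgebra k V →ₗ[k] PathAlgebra k V :=
  lift k fun p ↦ lift k fun q ↦ pathMul k p q

instance [DecidableEq V] : Mul (PathAlgebra k V) := ⟨fun x y ↦ mulHom k x y⟩

instance [Fintype V] : One (PathAlgebra k V) := ⟨∑ v : V, vertex k v⟩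

lemma mul_eq [DecidableEq V] (x y : PathAlgebra k V) : x * y = mulHom k x y := rfl

lemma one_eq [Fintype V] : (1 : PathAlgebra k V) = ∑ v : V, vertex k v := rfl

lemma ofPath_mul_ofPath [DecidableEq V] {a b c d : V} (p : Quiver.Path a b)
    (q : Quiver.Path c d) :
    ofPath k p * ofPath k q = pathMul k ⟨a, b, p⟩ ⟨c, d, q⟩ := by
  rw [mul_eq, mulHom, lift_ofPath, lift_ofPath]

lemma ofPath_mul_of_ne [DecidableEq V] {a b c d : V} (p : Quiver.Path a b)
    (q : Quiver.Path c d) (h : d ≠ a) : ofPath k p * ofPath k q = 0 := by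
  rw [ofPath_mul_ofPath, pathMul, dif_neg h]

lemma ofPath_mul_comp [DecidableEq V] {a b c : V} (p : Quiver.Path a b)
    (q : Quiver.Path c a) : ofPath k p * ofPath k q = ofPath k (q.comp p) := by
  rw [ofPath_mul_ofPath, pathMul, dif_pos rfl]
  rfl

@[elab_as_elim]
lemma induction_paths {motive : PathAlgebra k V → Prop} (x : PathAlgebra k V)
    (zero : motive 0) (add : ∀ x y, motive x → motive y → motive (x + y))
    (smul_path : ∀ (r : k) (a b : V) (p : Quiver.Path a b), motive (r • ofPath k p)) :
    motive x := by
  refine Finsupp.induction_linear x zero add ?_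
  rintro ⟨a, b, p⟩ r
  have h : r • ofPath k p = Finsupp.single ⟨a, b, p⟩ r :=
    (Finsupp.smul_single_one (⟨a, b, p⟩ : Σ a b : V, Quiver.Path a b) r)
  exact h ▸ smul_path r a b p

instance [DecidableEq V] : NonUnitalNonAssocRing (PathAlgebra k V) where
  left_distrib x y z := by simp only [mul_eq, map_add]
  right_distrib x y z := by simp only [mul_eq, map_add, LinearMap.add_apply]
  zero_mul x := by simp only [mul_eq, map_zero, LinearMap.zero_apply]
  mul_zero x := by simp only [mul_eq, map_zero]

lemma smul_mul' [DecidableEq V] (r : k) (x y : PathAlgebra k V) : (r • x) * y = r • (x * y) := by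
  simp only [mul_eq, map_smul, LinearMap.smul_apply]

lemma mul_smul' [DecidableEq V] (r : k) (x y : PathAlgebra k V) : x * (r • y) = r • (x * y) := by
  simp only [mul_eq, map_smul]

lemma mul_assoc' [DecidableEq V] (x y z : PathAlgebra k V) : x * y * z = x * (y * z) := by
  induction x using induction_paths with
  | zero => simp
  | add x x' hx hx' => simp only [add_mul, hx, hx']
  | smul_path r a b p =>
  induction y using induction_paths with
  | zero => simp
  | add y y' hy hy' => simp only [add_mul, mul_add, hy, hy']
  | smul_path s c d q =>
  induction z using induction_paths with
  | zero => simp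
  | add z z' hz hz' => simp only [mul_add, hz, hz']
  | smul_path t e f l =>
  simp only [smul_mul', mul_smul']
  congr 3
  by_cases h : d = a
  · subst h
    rw [ofPath_mul_comp]
    by_cases h' : f = c
    · subst h'
      rw [ofPath_mul_comp, ofPath_mul_comp, ofPath_mul_comp, Quiver.Path.comp_assoc]
    · rw [ofPath_mul_of_ne k _ _ h', ofPath_mul_of_ne k _ _ h', mul_zero]
  · rw [ofPath_mul_of_ne k _ _ h, zero_mul]
    by_cases h' : f = c
    · subst h'
      rw [ofPath_mul_comp, ofPath_mul_of_ne k _ _ h]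
    · rw [ofPath_mul_of_ne k _ _ h', mul_zero]

lemma one_mul' [DecidableEq V] [Fintype V] (x : PathAlgebra k V) : 1 * x = x := by
  induction x using induction_paths with
  | zero => simp
  | add x x' hx hx' => simp only [mul_add, hx, hx']
  | smul_path r a b p =>
  rw [mul_smul', one_eq, Finset.sum_mul, Finset.sum_eq_single b]
  · rw [vertex, ofPath_mul_comp, Quiver.Path.comp_nil]
  · intro c _ hc
    exact ofPath_mul_of_ne k _ _ hc.symm
  · simp

lemma mul_one' [DecidableEq V] [Fintype V] (x : PathAlgebra k V) : x * 1 = x := by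
  induction x using induction_paths with
  | zero => simp
  | add x x' hx hx' => simp only [add_mul, hx, hx']
  | smul_path r a b p =>
  rw [smul_mul', one_eq, Finset.mul_sum, Finset.sum_eq_single a]
  · rw [vertex, ofPath_mul_comp, Quiver.Path.nil_comp]
  · intro c _ hc
    exact ofPath_mul_of_ne k _ _ hc
  · simp

instance [DecidableEq V] [Fintype V] : Ring (PathAlgebra k V) where
  __ := (inferInstance : NonUnitalNonAssocRing (PathAlgebra k V))
  mul_assoc := mul_assoc' k
  one_mul := one_mul' k
  mul_one := mul_one' k

instance [DecidableEq V] [Fintype V] : Algebra k (PathAlgebra k V) :=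
  Algebra.ofModule (smul_mul' k) (mul_smul' k)

variable [DecidableEq V] [Fintype V]

/-- The right module `P_v` of all paths with target `v`, that is, the right ideal
`e_v A = {x | e_v x = x}` of the path algebra `A`. Right `A`-modules are modules over `Aᵐᵒᵖ`. -/
def proj (v : V) : Submodule (PathAlgebra k V)ᵐᵒᵖ (PathAlgebra k V) where
  carrier := {x | vertex k v * x = x}
  add_mem' {x y} hx hy := by
    simp only [Set.mem_ofPred_eq] at *
    rw [mul_add, hx, hy]
  zero_mem' := mul_zero _
  smul_mem' r x hx := by
    simp only [Set.mem_ofPred_eq, MulOpposite.smul_eq_mul_unop] at *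
    rw [← mul_assoc, hx]

lemma mem_proj_iff (v : V) (x : PathAlgebra k V) : x ∈ proj k v ↔ vertex k v * x = x := Iff.rfl

/-- `P_v` is the linear span of the paths with target `v`. -/
lemma proj_eq_span (v : V) :
    (proj k v : Set (PathAlgebra k V)) =
      Submodule.span k {x | ∃ (a : V) (p : Quiver.Path a v), x = ofPath k p} := by
  ext x
  constructor
  · intro hx
    rw [SetLike.mem_coe, mem_proj_iff] at hx
    rw [SetLike.mem_coe, ← hx]
    clear hx
    induction x using induction_paths with
    | zero => simp
    | add x y hx hy => rw [mul_add]; exact Submodule.add_mem _ hx hy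
    | smul_path r a b p =>
      rw [mul_smul']
      refine Submodule.smul_mem _ _ ?_
      by_cases h : b = v
      · subst h
        rw [vertex, ofPath_mul_comp]
        exact Submodule.subset_span ⟨a, _, rfl⟩
      · rw [vertex, ofPath_mul_of_ne k _ _ h]
        exact Submodule.zero_mem _
  · intro hx
    rw [SetLike.mem_coe] at hx ⊢
    rw [mem_proj_iff]
    induction hx using Submodule.span_induction with
    | mem x h =>
      obtain ⟨a, p, rfl⟩ := h
      rw [vertex, ofPath_mul_comp, Quiver.Path.comp_nil]
    | zero => simp
    | add x y _ _ hx hy => rw [mul_add, hx, hy]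
    | smul r x _ hx => rw [mul_smul', hx]

lemma vertex_mem_proj (v : V) : vertex k v ∈ proj k v := by
  rw [mem_proj_iff, vertex, ofPath_mul_comp, Quiver.Path.comp_nil]

instance (v : V) : Module.Finite (PathAlgebra k V)ᵐᵒᵖ (proj k v) := by
  refine ⟨⟨{⟨vertex k v, vertex_mem_proj k v⟩}, ?_⟩⟩
  rw [eq_top_iff]
  rintro ⟨x, hx⟩ -
  rw [Finset.coe_singleton, Submodule.mem_span_singleton]
  exact ⟨MulOpposite.op x, Subtype.ext hx⟩

/-- The map of right modules `P_a ⟶ P_b` given by an arrow `f : a ⟶ b`: a path with target `a` is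
continued by `f`. -/
def projMap {a b : V} (f : a ⟶ b) :
    proj k a →ₗ[(PathAlgebra k V)ᵐᵒᵖ] proj k b where
  toFun x := ⟨arrow k f * x.1, by
    rw [mem_proj_iff, ← mul_assoc, arrow, vertex, ofPath_mul_comp, Quiver.Path.comp_nil]⟩
  map_add' x y := Subtype.ext (mul_add _ _ _)
  map_smul' r x := Subtype.ext (by
    simp only [SetLike.val_smul, MulOpposite.smul_eq_mul_unop, RingHom.id_apply, mul_assoc])

end

end PathAlgebra

/-! ### The quivers of type `A_n` -/

/-- The orientation `𝔬(e_i)` of the edge `e_i` given by `J`: it is `-1` iff `i ∈ J`. -/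
def orientation (J : Finset ℕ) (i : ℕ) : ℤ := if i ∈ J then -1 else 1

/-- The vertices of the quiver `Γ_J` with underlying graph `A_n`.
The vertex `v_j`, `1 ≤ j ≤ n`, is the element `j - 1` of `Fin n`. -/
def GammaQuiver (n : ℕ) (_J : Finset ℕ) : Type := Fin n

namespace GammaQuiver

variable {n : ℕ} {J : Finset ℕ}

instance : DecidableEq (GammaQuiver n J) := inferInstanceAs (DecidableEq (Fin n))

instance : Fintype (GammaQuiver n J) := inferInstanceAs (Fintype (Fin n))

/-- The vertex `v_{i+1}`. -/
def vert (J : Finset ℕ) (i : Fin n) : GammaQuiver n J := i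

/-- The index `j ∈ {1, …, n}` of a vertex `v_j`. -/
def index (a : GammaQuiver n J) : ℕ := (show Fin n from a).val + 1

/-- For `2 ≤ j ≤ n` there is one arrow between `v_{j-1}` and `v_j`, the edge `e_j`; it goes from
`v_{j-1}` to `v_j` if `𝔬(e_j) = 1` and from `v_j` to `v_{j-1}` if `𝔬(e_j) = -1`. -/
instance : Quiver.{0} (GammaQuiver n J) where
  Hom a b := PLift ((b.index = a.index + 1 ∧ orientation J b.index = 1) ∨
    (a.index = b.index + 1 ∧ orientation J a.index = -1))

/-- The edge `e_{i+2}`, when it is directed from `v_{i+2}` to `v_{i+1}`. -/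
def leftArrow (i : Fin n) (hi : i.val + 1 < n) (ho : orientation J (i.val + 2) = -1) :
    vert J ⟨i.val + 1, hi⟩ ⟶ vert J i :=
  PLift.up (Or.inr ⟨rfl, ho⟩)

/-- A height function, which goes up by one along each arrow. -/
def height (a : GammaQuiver n J) : ℤ := ∑ j ∈ Finset.Icc 2 a.index, orientation J j

lemma height_arrow {a b : GammaQuiver n J} (f : a ⟶ b) : b.height = a.height + 1 := by
  have key : ∀ x y : GammaQuiver n J, y.index = x.index + 1 →
      y.height = x.height + orientation J y.index := by
    intro x y h
    have hx : 1 ≤ x.index := Nat.le_add_left 1 _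
    rw [height, height, h, Finset.sum_Icc_succ_top (by omega)]
  rcases f.down with ⟨h, ho⟩ | ⟨h, ho⟩
  · rw [key a b h, ho]
  · have := key b a h
    rw [ho] at this
    omega

lemma height_path {a b : GammaQuiver n J} (p : Quiver.Path a b) :
    b.height = a.height + p.length := by
  induction p with
  | nil => simp
  | cons p f ih =>
    rw [height_arrow f, ih, Quiver.Path.length_cons]
    push_cast
    ring

instance (a b : GammaQuiver n J) : Finite (a ⟶ b) := by
  have : Subsingleton (a ⟶ b) := ⟨fun ⟨_⟩ ⟨_⟩ ↦ rfl⟩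
  infer_instance

lemma finite_paths_length (m : ℕ) (a b : GammaQuiver n J) :
    Finite {p : Quiver.Path a b // p.length = m} := by
  induction m generalizing b with
  | zero =>
    have : Subsingleton {p : Quiver.Path a b // p.length = 0} := by
      refine ⟨?_⟩
      rintro ⟨p, hp⟩ ⟨q, hq⟩
      have hab := Quiver.Path.eq_of_length_zero p hp
      subst hab
      rw [Subtype.mk.injEq, Quiver.Path.eq_nil_of_length_zero p hp,
        Quiver.Path.eq_nil_of_length_zero q hq]
    infer_instance
  | succ m ih =>
    let F : (Σ c : GammaQuiver n J, {p : Quiver.Path a c // p.length = m} × (c ⟶ b)) →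
        {p : Quiver.Path a b // p.length = m + 1} :=
      fun x ↦ ⟨x.2.1.1.cons x.2.2, by rw [Quiver.Path.length_cons, x.2.1.2]⟩
    refine Finite.of_surjective F ?_
    rintro ⟨p, hp⟩
    cases p with
    | nil => simp at hp
    | cons p f =>
      rw [Quiver.Path.length_cons, Nat.add_right_cancel_iff] at hp
      exact ⟨⟨_, ⟨p, hp⟩, f⟩, rfl⟩

instance (a b : GammaQuiver n J) : Finite (Quiver.Path a b) := by
  have := finite_paths_length (b.height - a.height).toNat a b
  refine Finite.of_injective
    (fun p ↦ (⟨p, by have := height_path p; omega⟩ :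
      {p : Quiver.Path a b // p.length = (b.height - a.height).toNat})) ?_
  intro p q h
  exact congrArg Subtype.val h

instance (k : Type u) [Field k] : Module.Finite k (PathAlgebra k (GammaQuiver n J)) :=
  inferInstanceAs (Module.Finite k
    ((Σ a b : GammaQuiver n J, Quiver.Path a b) →₀ k))

end GammaQuiver

/-- The path algebra of `Γ_J`. -/
abbrev GammaAlgebra (k : Type u) [Field k] (n : ℕ) (J : Finset ℕ) : Type u :=
  PathAlgebra k (GammaQuiver n J)

instance (k : Type u) [Field k] (n : ℕ) (J : Finset ℕ) :
    IsNoetherianRing (GammaAlgebra k n J)ᵐᵒᵖ :=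
  IsNoetherianRing.of_finite k _

/-- The category of finitely generated right modules over a ring. -/
abbrev RightMod (R : Type u) [Ring R] : Type (max u (v + 1)) := FGModuleCat.{v} Rᵐᵒᵖ

/-- The bounded derived category `𝓓` of finitely generated right modules over the path algebra
of `Γ_J`. -/
abbrev GammaDerived (k : Type u) [Field k] (n : ℕ) (J : Finset ℕ)
    [HasDerivedCategory.{w} (RightMod.{u} (GammaAlgebra k n J))] : Type (u + 1) :=
  DerivedCategory.Bounded (RightMod.{u} (GammaAlgebra k n J))

/-! ### Exceptional collections and Yoneda algebras -/

section Exceptional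

variable {D : Type u} [Category.{v} D] [Preadditive D] [HasZeroObject D] [HasShift D ℤ]
  [∀ m : ℤ, (shiftFunctor D m).Additive] [Pretriangulated D]

/-- `⟨E_1, …, E_n⟩` is an exceptional collection in the `k`-linear triangulated category `D`:
`Hom(E_i, E_i) = k`, `Hom(E_i, E_i[m]) = 0` for `m ≠ 0`, and `Hom(E_j, E_i[m]) = 0` for `i < j`
and all `m`. -/
structure IsExceptionalCollection (k : Type w) [Field k] [Linear k D] {n : ℕ}
    (E : Fin n → D) : Prop where
  bijective_smul_id (i : Fin n) : Function.Bijective fun c : k ↦ c • 𝟙 (E i)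
  self_eq_zero (i : Fin n) (m : ℤ) (hm : m ≠ 0) (f : E i ⟶ (E i)⟦m⟧) : f = 0
  eq_zero_of_lt (i j : Fin n) (hij : i < j) (m : ℤ) (f : E j ⟶ (E i)⟦m⟧) : f = 0

/-- A collection is strong if `Hom(E_i, E_j[m]) = 0` for all `i`, `j` and all `m ≠ 0`. -/
def IsStrongCollection {n : ℕ} (E : Fin n → D) : Prop :=
  ∀ (i j : Fin n) (m : ℤ), m ≠ 0 → ∀ f : E i ⟶ (E j)⟦m⟧, f = 0

/-- A collection is complete if it generates `D`: the only strictly full triangulated subcategory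
of `D` which contains all `E_i` is `D` itself. -/
def IsCompleteCollection {n : ℕ} (E : Fin n → D) : Prop :=
  ∀ P : ObjectProperty D, P.IsClosedUnderIsomorphisms → P.IsTriangulated →
    (∀ i, P (E i)) → ∀ X : D, P X

end Exceptional

section Yoneda

variable {D : Type u} [Category.{v} D] [HasShift D ℤ]

/-- `Ext^m(X, X) = Hom(X, X[m])`. -/
abbrev SelfExt (X : D) (m : ℤ) : Type v := ShiftedHom X X m

noncomputable instance (X : D) : GradedMonoid.GOne (SelfExt X) where
  one := ShiftedHom.mk₀ 0 rfl (𝟙 X)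

/-- The Yoneda product: `f * g` is "first `g`, then `f`". -/
noncomputable instance (X : D) : GradedMonoid.GMul (SelfExt X) where
  mul f g := ShiftedHom.comp g f rfl

lemma SelfExt.mk_mul_mk {X : D} {a b c : ℤ} (f : SelfExt X a) (g : SelfExt X b)
    (h : a + b = c) :
    (GradedMonoid.mk a f * GradedMonoid.mk b g : GradedMonoid (SelfExt X)) =
      GradedMonoid.mk c (ShiftedHom.comp g f h) := by
  subst h
  rfl

noncomputable instance (X : D) : GradedMonoid.GMonoid (SelfExt X) where
  one_mul := by
    rintro ⟨a, f⟩
    refine (SelfExt.mk_mul_mk _ _ (zero_add a)).trans ?_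
    exact congrArg (GradedMonoid.mk a) (ShiftedHom.comp_mk₀_id f 0 rfl)
  mul_one := by
    rintro ⟨a, f⟩
    refine (SelfExt.mk_mul_mk _ _ (add_zero a)).trans ?_
    exact congrArg (GradedMonoid.mk a) (ShiftedHom.mk₀_id_comp 0 rfl f)
  mul_assoc := by
    rintro ⟨a, f⟩ ⟨b, g⟩ ⟨c, h⟩
    refine (SelfExt.mk_mul_mk (ShiftedHom.comp g f rfl) h (add_assoc a b c)).trans ?_
    exact congrArg (GradedMonoid.mk (a + (b + c)))
      (ShiftedHom.comp_assoc h g f rfl rfl (add_assoc a b c)).symm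

variable [Preadditive D] [∀ m : ℤ, (shiftFunctor D m).Additive]

noncomputable instance (X : D) : DirectSum.GRing (SelfExt X) where
  __ := (inferInstance : GradedMonoid.GMonoid (SelfExt X))
  mul_zero f := ShiftedHom.zero_comp X _ f rfl
  zero_mul f := ShiftedHom.comp_zero _ f rfl
  mul_add f g h := ShiftedHom.add_comp g h f rfl
  add_mul f g h := ShiftedHom.comp_add h f g rfl
  natCast m := m • ShiftedHom.mk₀ 0 rfl (𝟙 X)
  natCast_zero := zero_smul _ _
  natCast_succ _ := succ_nsmul _ _
  intCast m := m • ShiftedHom.mk₀ 0 rfl (𝟙 X)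
  intCast_ofNat _ := natCast_zsmul _ _
  intCast_negSucc_ofNat _ := negSucc_zsmul _ _

/-- The algebra `Ext^*(X, X) = ⨁_m Hom(X, X[m])`. -/
abbrev ExtAlgebra (X : D) : Type v := ⨁ m : ℤ, SelfExt X m

/-- The Yoneda algebra `R_E = Ext^*(⨁ E_i, ⨁ E_i)` of a collection. -/
abbrev YonedaAlgebra [HasFiniteBiproducts D] {n : ℕ} (E : Fin n → D) : Type v :=
  ExtAlgebra (⨁ E)

end Yoneda

/-! ### The perversity, the t-structure and the collection `E_J` -/

/-- The perversity `p_J(j) = (j - 1) / 2 - (1 / 2) ∑_{i = 1}^{j - 1} 𝔬(e_{i+1})`.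
The division is exact and the value is the number of elements of `J` in `{2, …, j}`. -/
def perversity (J : Finset ℕ) (j : ℕ) : ℤ :=
  (((j : ℤ) - 1) - ∑ i ∈ Finset.Icc 1 (j - 1), orientation J (i + 1)) / 2

lemma perversity_eq_card (J : Finset ℕ) (j : ℕ) (hj : 1 ≤ j) :
    perversity J j = (J.filter fun i ↦ 2 ≤ i ∧ i ≤ j).card := by
  obtain ⟨m, rfl⟩ : ∃ m, j = m + 1 := ⟨j - 1, by omega⟩
  have key : ((m + 1 : ℕ) : ℤ) - 1 - ∑ i ∈ Finset.Icc 1 m, orientation J (i + 1) =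
      2 * ((J.filter fun i ↦ 2 ≤ i ∧ i ≤ m + 1).card : ℤ) := by
    induction m with
    | zero =>
      have : (J.filter fun i ↦ 2 ≤ i ∧ i ≤ 0 + 1) = ∅ := by
        ext i
        simp only [Finset.mem_filter, Finset.notMem_empty, iff_false]
        omega
      simp [this]
    | succ m ih =>
      have ih := ih (by omega)
      rw [Finset.sum_Icc_succ_top (by omega)]
      by_cases h : m + 1 + 1 ∈ J
      · have : (J.filter fun i ↦ 2 ≤ i ∧ i ≤ m + 1 + 1) =
            insert (m + 1 + 1) (J.filter fun i ↦ 2 ≤ i ∧ i ≤ m + 1) := by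
          ext i
          simp only [Finset.mem_filter, Finset.mem_insert]
          constructor
          · rintro ⟨h1, h2, h3⟩
            by_cases hi : i = m + 1 + 1
            · exact Or.inl hi
            · exact Or.inr ⟨h1, h2, by omega⟩
          · rintro (rfl | ⟨h1, h2, h3⟩)
            · exact ⟨h, by omega, le_rfl⟩
            · exact ⟨h1, h2, by omega⟩
        rw [this, Finset.card_insert_of_notMem (by simp), orientation, if_pos h]
        push_cast at ih ⊢
        linarith
      · have : (J.filter fun i ↦ 2 ≤ i ∧ i ≤ m + 1 + 1) =
            (J.filter fun i ↦ 2 ≤ i ∧ i ≤ m + 1) := by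
          ext i
          simp only [Finset.mem_filter]
          constructor
          · rintro ⟨h1, h2, h3⟩
            refine ⟨h1, h2, ?_⟩
            have : i ≠ m + 1 + 1 := fun hi ↦ h (hi ▸ h1)
            omega
          · rintro ⟨h1, h2, h3⟩
            exact ⟨h1, h2, by omega⟩
        rw [this, orientation, if_neg h]
        push_cast at ih ⊢
        linarith
  rw [perversity, Nat.add_sub_cancel, key]
  omega

noncomputable section

variable (k : Type u) [Field k] (n : ℕ) (J : Finset ℕ)

/-- The right module `P_{i+1}` of all paths with target `v_{i+1}`. -/
def gammaProj (i : Fin n) : RightMod.{u} (GammaAlgebra k n J) :=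
  FGModuleCat.of _ (PathAlgebra.proj k (GammaQuiver.vert J i))

/-- The map `P_{i+2} ⟶ P_{i+1}` given by the edge `e_{i+2}`, when this edge is directed from
`v_{i+2}` to `v_{i+1}`. -/
def gammaProjMap (i : Fin n) (hi : i.val + 1 < n) (ho : orientation J (i.val + 2) = -1) :
    gammaProj k n J ⟨i.val + 1, hi⟩ ⟶ gammaProj k n J i :=
  FGModuleCat.ofHom (PathAlgebra.projMap k (GammaQuiver.leftArrow i hi ho))

variable [HasDerivedCategory.{w} (RightMod.{u} (GammaAlgebra k n J))]

/-- A module, as an object of the bounded derived category. -/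
def toDerived (M : RightMod.{u} (GammaAlgebra k n J)) : GammaDerived k n J where
  obj := DerivedCategory.Q.obj ((CochainComplex.singleFunctor _ 0).obj M)
  property := by
    change DerivedCategory.TStructure.t.bounded ((DerivedCategory.singleFunctor _ 0).obj M)
    exact ⟨⟨0, inferInstance⟩, ⟨0, inferInstance⟩⟩

/-- The cone of a map `φ : M ⟶ N` of modules, that is the complex `M ⟶ N` with `N` in degree `0`,
as an object of the bounded derived category. -/
def coneDerived {M N : RightMod.{u} (GammaAlgebra k n J)} (φ : M ⟶ N) : GammaDerived k n J where
  obj := DerivedCategory.Q.obj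
    (CochainComplex.mappingCone ((CochainComplex.singleFunctor _ 0).map φ))
  property :=
    ObjectProperty.ext_of_isTriangulatedClosed₃ DerivedCategory.TStructure.t.bounded _
      (DerivedCategory.mappingCone_triangle_distinguished
        ((CochainComplex.singleFunctor _ 0).map φ))
      (toDerived k n J M).property (toDerived k n J N).property

/-- The object `E_{i+1}` of the collection `E_J`. If `e_{i+2}` exists and is directed from `v_{i+2}`
to `v_{i+1}`, it is the cone of the map `P_{i+2} ⟶ P_{i+1}` given by `e_{i+2}`, shifted by
`p_J(i+1)`: the complex with `P_{i+1}` in homological degree `p_J(i+1)` and with `P_{i+2}` in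
homological degree `p_J(i+2) = p_J(i+1) + 1`. Otherwise it is `P_{i+1}[p_J(i+1)]`. -/
def collectionE (i : Fin n) : GammaDerived k n J :=
  if h : i.val + 1 < n ∧ orientation J (i.val + 2) = -1 then
    (coneDerived k n J (gammaProjMap k n J i h.1 h.2))⟦perversity J (i.val + 1)⟧
  else
    (toDerived k n J (gammaProj k n J i))⟦perversity J (i.val + 1)⟧

/-- The subcategory `𝓓^{≥ 0}_J` of all complexes `C` with `H_m(Hom(P_j, C)) = 0` for all `j` and all
`m < p_J(j)`, in homological grading. As `P_j` is projective, `H_m(Hom(P_j, C))` is the group of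
morphisms from `P_j` to `C[-m]` in the derived category. -/
def perverseGE : ObjectProperty (GammaDerived k n J) := fun C ↦
  ∀ (i : Fin n) (m : ℤ), m < perversity J (i.val + 1) →
    ∀ f : toDerived k n J (gammaProj k n J i) ⟶ C⟦-m⟧, f = 0

/-- The other half `𝓓^{≤ 0}_J` of the t-structure: all objects `C` such that `Hom(X[1], C) = 0`
for all `X` in `𝓓^{≥ 0}_J`. -/
def perverseLE : ObjectProperty (GammaDerived k n J) := fun C ↦
  ∀ X : GammaDerived k n J, perverseGE k n J X → ∀ f : X⟦(1 : ℤ)⟧ ⟶ C, f = 0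

end

/-! Let `M_i` be `E_i` before its shift: the cone of `P_{i+1} → P_i`, or `P_i` itself. In a quiver
of type A a path never turns back, and two vertices are joined by at most one path in each
direction. So `Hom(P_a, P_j)` is `k` if all edges between `v_a` and `v_j` point towards `v_j`, and
zero otherwise. When `i + 1 ∈ J`, the map `P_{i+1} → P_i` is injective, and every map `P_a → P_i`
with `a > i` factors through it. Hence `Hom(P_a, M_j[m])` can be nonzero only if `m = 0`, `a ≤ j`
and no edge `e_s` with `a < s ≤ j` lies in `J`. But then `p_J(a) = p_J(j)`, so the perverse shifts
leave this group in degree 0 (`homVanishes_PM_perversity`). As `p_J` jumps by one exactly at the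
edges in `J`, the object `E_i` is, when it is a cone, an extension of `P_{i+1}[p_J(i+1)]` and
`P_i[p_J(i)]`. The vanishing therefore passes to the `E_i` in the source
(`homVanishes_MM_perversity`). The same triangles, read by descending induction on `i`, show that
the `E_i` and the shifted `P_i` cut out the same half of the t-structure (`tiltLE_zero_iff`), and
that only zero is orthogonal to all `E_i`.

The rest is formal for a strong exceptional collection with finite total Hom and trivial orthogonal.
Coning off a nonzero map `E_i[-m] → X` lowers the total dimension of `Hom(E_i, X[*])`. If the
indices `i` are treated in decreasing order, the work done for larger indices is never undone
(`vanishFrom_succ_le`). Doing this in all degrees gives completeness; doing it in degrees `m ≤ 0`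
gives the truncation triangles of a t-structure (`tilt_exists_triangle`).

In its heart `T = ⨁ E_i` behaves as a projective generator. Covers by `T^r` make `Hom(T, -)` fully
faithful, truncated cones of maps `T^s → T^r` realise every finitely generated module, and `Ext^*(T,
T) = End T` by strongness. -/

/-! ### Vanishing and finiteness of graded Homs in triangulated categories -/

section HomVanishes

variable {D : Type u} [Category.{v} D] [HasShift D ℤ]

/-- `Hom(P, X[m]) = 0`. -/
def HomVanishes [HasZeroMorphisms D] (P X : D) (m : ℤ) : Prop := ∀ f : P ⟶ X⟦m⟧, f = 0

section

variable [HasZeroMorphisms D]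

omit [HasShift D ℤ] in
lemma hom_eq_zero_of_iso {P P' X X' : D} (e : P ≅ P') (e' : X ≅ X')
    (h : ∀ f : P ⟶ X, f = 0) (f : P' ⟶ X') : f = 0 := by
  have := h (e.hom ≫ f ≫ e'.inv)
  rw [← cancel_epi e.hom, ← cancel_mono e'.inv, Category.assoc, this]
  simp

lemma HomVanishes.of_iso {P P' X X' : D} {m : ℤ} (e : P ≅ P') (e' : X ≅ X')
    (h : HomVanishes P X m) : HomVanishes P' X' m :=
  hom_eq_zero_of_iso e ((shiftFunctor D m).mapIso e') h

lemma HomVanishes.of_isZero {P X : D} (m : ℤ) (h : IsZero P) : HomVanishes P X m :=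
  fun _ ↦ h.eq_of_src _ _

lemma homVanishes_shift_right_iff {P X : D} (a m l : ℤ) (h : a + m = l) :
    HomVanishes P (X⟦a⟧) m ↔ HomVanishes P X l :=
  ⟨hom_eq_zero_of_iso (Iso.refl _) ((shiftFunctorAdd' D a m l h).symm.app X),
    hom_eq_zero_of_iso (Iso.refl _) ((shiftFunctorAdd' D a m l h).app X)⟩

lemma homVanishes_zero_iff {P X : D} : HomVanishes P X 0 ↔ ∀ f : P ⟶ X, f = 0 :=
  ⟨hom_eq_zero_of_iso (Iso.refl _) ((shiftFunctorZero D ℤ).app X),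
    hom_eq_zero_of_iso (Iso.refl _) ((shiftFunctorZero D ℤ).symm.app X)⟩

end

variable [Preadditive D] [∀ m : ℤ, (shiftFunctor D m).Additive]

lemma forall_shift_map_eq_zero_iff {P X : D} (a : ℤ) :
    (∀ f : P⟦a⟧ ⟶ X⟦a⟧, f = 0) ↔ ∀ f : P ⟶ X, f = 0 := by
  refine ⟨fun h f ↦ (shiftFunctor D a).map_injective ((h _).trans (Functor.map_zero _ _ _).symm),
    fun h f ↦ ?_⟩
  obtain ⟨g, rfl⟩ := (shiftFunctor D a).map_surjective f
  rw [h g, Functor.map_zero]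

lemma homVanishes_shift_left_iff {P X : D} (a m l : ℤ) (h : l + a = m) :
    HomVanishes (P⟦a⟧) X m ↔ HomVanishes P X l := by
  rw [HomVanishes, HomVanishes, ← forall_shift_map_eq_zero_iff (P := P) a]
  exact ⟨hom_eq_zero_of_iso (Iso.refl _) ((shiftFunctorAdd' D l a m h).app X),
    hom_eq_zero_of_iso (Iso.refl _) ((shiftFunctorAdd' D l a m h).symm.app X)⟩

lemma hom_shift_eq_zero_iff {P X : D} (a : ℤ) :
    (∀ f : P⟦a⟧ ⟶ X, f = 0) ↔ HomVanishes P X (-a) := by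
  rw [← homVanishes_shift_left_iff a 0 (-a) (by omega), homVanishes_zero_iff]

variable [HasZeroObject D] [Pretriangulated D]

open Pretriangulated

variable {T : Triangle D}

/-- Shifting a triangle by `m` multiplies its maps by `(-1)^m`. The sign is absorbed into the lift,
so that exactness can be used for the unsigned shifted maps. -/
lemma coyoneda_shift_exact₂ (hT : T ∈ distTriang D) {P : D} (m : ℤ) (f : P ⟶ T.obj₂⟦m⟧)
    (hf : f ≫ T.mor₂⟦m⟧' = 0) : ∃ g : P ⟶ T.obj₁⟦m⟧, f = g ≫ T.mor₁⟦m⟧' := by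
  obtain ⟨g, hg⟩ := Triangle.coyoneda_exact₂ _ (Triangle.shift_distinguished T hT m) f (by
    change f ≫ (m.negOnePow • T.mor₂⟦m⟧') = 0
    rw [Linear.comp_units_smul, hf, smul_zero])
  let g' : P ⟶ T.obj₁⟦m⟧ := g
  have hg' : f = g' ≫ (m.negOnePow • T.mor₁⟦m⟧') := hg
  exact ⟨m.negOnePow • g', by rw [hg', Linear.units_smul_comp, Linear.comp_units_smul]⟩

lemma coyoneda_shift_exact₃ (hT : T ∈ distTriang D) {P : D} (m : ℤ) (f : P ⟶ T.obj₃⟦m⟧)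
    (hf : f ≫ T.mor₃⟦m⟧' = 0) : ∃ g : P ⟶ T.obj₂⟦m⟧, f = g ≫ T.mor₂⟦m⟧' :=
  coyoneda_shift_exact₂ (rot_of_distTriang _ hT) m f hf

lemma HomVanishes.obj₂ (hT : T ∈ distTriang D) {P : D} {m : ℤ} (h₁ : HomVanishes P T.obj₁ m)
    (h₃ : HomVanishes P T.obj₃ m) : HomVanishes P T.obj₂ m := by
  intro f
  obtain ⟨g, hg⟩ := coyoneda_shift_exact₂ hT m f (h₃ _)
  rw [hg, h₁ g, zero_comp]

lemma HomVanishes.obj₃ (hT : T ∈ distTriang D) {P : D} (m l : ℤ) (hm : m + 1 = l)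
    (h₂ : HomVanishes P T.obj₂ m) (h₁ : HomVanishes P T.obj₁ l) : HomVanishes P T.obj₃ m :=
  HomVanishes.obj₂ (rot_of_distTriang _ hT) h₂
    ((homVanishes_shift_right_iff 1 m l (by omega)).2 h₁)

lemma HomVanishes.obj₁ (hT : T ∈ distTriang D) {P : D} (m l : ℤ) (hm : m + 1 = l)
    (h₃ : HomVanishes P T.obj₃ m) (h₂ : HomVanishes P T.obj₂ l) : HomVanishes P T.obj₁ l :=
  HomVanishes.obj₂ (inv_rot_of_distTriang _ hT)
    ((homVanishes_shift_right_iff (-1) l m (by omega)).2 h₃) h₂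

lemma HomVanishes.src_obj₂ (hT : T ∈ distTriang D) {X : D} {m : ℤ} (h₁ : HomVanishes T.obj₁ X m)
    (h₃ : HomVanishes T.obj₃ X m) : HomVanishes T.obj₂ X m := by
  intro f
  obtain ⟨g, hg⟩ := Triangle.yoneda_exact₂ _ hT f (h₁ _)
  rw [hg, h₃ g, comp_zero]

lemma HomVanishes.src_obj₃ (hT : T ∈ distTriang D) {X : D} (m l : ℤ) (hm : m + 1 = l)
    (h₁ : HomVanishes T.obj₁ X m) (h₂ : HomVanishes T.obj₂ X l) : HomVanishes T.obj₃ X l :=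
  HomVanishes.src_obj₂ (rot_of_distTriang _ hT) h₂
    ((homVanishes_shift_left_iff 1 l m hm).2 h₁)

/-! ### Finite-dimensionality of Hom along triangles -/

section Finite

variable (k : Type w) [Field k] [Linear k D]

lemma finite_hom_obj₂ (hT : T ∈ distTriang D) {P : D} (h₁ : Module.Finite k (P ⟶ T.obj₁))
    (h₃ : Module.Finite k (P ⟶ T.obj₃)) : Module.Finite k (P ⟶ T.obj₂) := by
  have := isNoetherian_of_range_eq_ker (Linear.rightComp k P T.mor₁)
    (Linear.rightComp k P T.mor₂) (by
      ext f
      constructor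
      · rintro ⟨g, rfl⟩
        change (g ≫ T.mor₁) ≫ T.mor₂ = 0
        rw [Category.assoc, comp_distTriang_mor_zero₁₂ T hT, comp_zero]
      · intro hf
        obtain ⟨g, hg⟩ := Triangle.coyoneda_exact₂ _ hT f hf
        exact ⟨g, hg.symm⟩)
  infer_instance

lemma finite_hom_src_obj₂ (hT : T ∈ distTriang D) {X : D} (h₁ : Module.Finite k (T.obj₁ ⟶ X))
    (h₃ : Module.Finite k (T.obj₃ ⟶ X)) : Module.Finite k (T.obj₂ ⟶ X) := by
  have := isNoetherian_of_range_eq_ker (Linear.leftComp k X T.mor₂)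
    (Linear.leftComp k X T.mor₁) (by
      ext f
      constructor
      · rintro ⟨g, rfl⟩
        change T.mor₁ ≫ T.mor₂ ≫ g = 0
        rw [← Category.assoc, comp_distTriang_mor_zero₁₂ T hT, zero_comp]
      · intro hf
        obtain ⟨g, hg⟩ := Triangle.yoneda_exact₂ _ hT f hf
        exact ⟨g, hg.symm⟩)
  infer_instance

omit [HasShift D ℤ] [∀ (m : ℤ), (shiftFunctor D m).Additive] [HasZeroObject D] [Pretriangulated D] in
lemma finite_hom_of_iso {P P' X X' : D} (e : P ≅ P') (e' : X ≅ X')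
    (h : Module.Finite k (P ⟶ X)) : Module.Finite k (P' ⟶ X') :=
  Module.Finite.of_surjective
    ((Linear.leftComp k X' e.inv).comp (Linear.rightComp k P e'.hom))
    fun f ↦ ⟨e.hom ≫ f ≫ e'.inv, by simp⟩

end Finite

end HomVanishes

/-! ### Truncation along an exceptional collection -/

section Truncation

variable {D : Type u} [Category.{v} D] [Preadditive D] [HasZeroObject D] [HasShift D ℤ]
  [∀ m : ℤ, (shiftFunctor D m).Additive] [Pretriangulated D]
  (k : Type w) [Field k] [Linear k D]

open Pretriangulated

/-- `Hom(P, X[m])` is finite dimensional for all `X` and `m`, and zero for almost all `m`. -/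
structure HomFiniteBounded (P : D) : Prop where
  finite (X : D) : Module.Finite k (P ⟶ X)
  bounded (X : D) : ∃ N : ℕ, ∀ m : ℤ, N < |m| → HomVanishes P X m

omit [HasZeroObject D] [∀ m : ℤ, (shiftFunctor D m).Additive] [Pretriangulated D] [HasShift D ℤ] in
lemma hom_eq_smul_of_iso {P Y : D} (hP : Function.Surjective fun c : k ↦ c • 𝟙 P) (e : P ≅ Y)
    (u : P ⟶ Y) : ∃ c : k, u = c • e.hom := by
  obtain ⟨c, hc⟩ := hP (u ≫ e.inv)
  refine ⟨c, ?_⟩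
  rw [← cancel_mono e.inv, Linear.smul_comp, e.hom_inv_id]
  exact hc.symm

variable {k}

/-- In the triangle of a nonzero map `P[-m] ⟶ X`, where `Hom(P, P) = k` and `Hom(P, P[l]) = 0`
for `l ≠ 0`, the cone has no new maps from the shifts of `P`. -/
lemma exists_lift_of_cone {P X Y : D} (hP : Function.Surjective fun c : k ↦ c • 𝟙 P)
    (hP' : ∀ m ≠ 0, HomVanishes P P m) (m : ℤ) {f : P⟦-m⟧ ⟶ X} (hf : f ≠ 0) {g : X ⟶ Y}
    {h : Y ⟶ P⟦-m⟧⟦(1 : ℤ)⟧} (hT : Triangle.mk f g h ∈ distTriang D) (l : ℤ)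
    (u : P ⟶ Y⟦l⟧) : ∃ v : P ⟶ X⟦l⟧, u = v ≫ g⟦l⟧' := by
  refine coyoneda_shift_exact₃ hT l u ?_
  change u ≫ h⟦l⟧' = 0
  -- Only in this degree can `Hom(P, P[-m][1][l])` be nonzero. There the obstruction is `c` times an
  -- isomorphism, and it is killed by the shift of `f`; as `f ≠ 0`, the scalar `c` is zero.
  by_cases hl : l + 1 = m
  · let e : P ≅ P⟦-m⟧⟦(1 : ℤ)⟧⟦l⟧ :=
      (shiftFunctorZero D ℤ).symm.app P ≪≫ (shiftFunctorAdd' D (-m + 1) l 0 (by omega)).app P ≪≫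
        (shiftFunctor D l).mapIso ((shiftFunctorAdd' D (-m) 1 (-m + 1) rfl).app P)
    obtain ⟨c, hc⟩ := hom_eq_smul_of_iso k hP e (u ≫ h⟦l⟧')
    have h0 : (u ≫ h⟦l⟧') ≫ f⟦(1 : ℤ)⟧'⟦l⟧' = 0 := by
      have : h ≫ f⟦(1 : ℤ)⟧' = 0 := comp_distTriang_mor_zero₃₁ _ hT
      rw [Category.assoc, ← Functor.map_comp, this, Functor.map_zero, comp_zero]
    rw [hc, Linear.smul_comp] at h0
    rcases smul_eq_zero.1 h0 with h0 | h0
    · rw [hc, h0, zero_smul]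
    · exfalso
      apply hf
      apply (shiftFunctor D (1 : ℤ)).map_injective
      apply (shiftFunctor D l).map_injective
      rw [← cancel_epi e.hom, h0]
      simp
  · have h1 : HomVanishes P (P⟦-m⟧⟦(1 : ℤ)⟧) l := by
      rw [homVanishes_shift_right_iff 1 l (1 + l) rfl,
        homVanishes_shift_right_iff (-m) (1 + l) _ rfl]
      exact hP' _ (by omega)
    exact h1 _

omit [HasZeroObject D] [HasShift D ℤ] [∀ m : ℤ, (shiftFunctor D m).Additive] [Pretriangulated D] in
lemma finrank_hom_le_of_surjective {P X Y : D} [Module.Finite k (P ⟶ X)] (g : X ⟶ Y)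
    (hg : ∀ u : P ⟶ Y, ∃ v : P ⟶ X, u = v ≫ g) :
    Module.finrank k (P ⟶ Y) ≤ Module.finrank k (P ⟶ X) :=
  LinearMap.finrank_le_finrank_of_surjective (f := Linear.rightComp k P g)
    fun u ↦ (hg u).imp fun _ h ↦ h.symm

omit [HasZeroObject D] [HasShift D ℤ] [∀ m : ℤ, (shiftFunctor D m).Additive] [Pretriangulated D] in
lemma finrank_hom_lt_of_surjective {P X Y : D} [Module.Finite k (P ⟶ X)] (g : X ⟶ Y)
    (hg : ∀ u : P ⟶ Y, ∃ v : P ⟶ X, u = v ≫ g) (f : P ⟶ X) (hf : f ≠ 0) (hfg : f ≫ g = 0) :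
    Module.finrank k (P ⟶ Y) < Module.finrank k (P ⟶ X) := by
  have h1 := LinearMap.finrank_range_add_finrank_ker (Linear.rightComp k P g)
  rw [LinearMap.range_eq_top.2 fun u ↦ (hg u).imp fun _ h ↦ h.symm, finrank_top] at h1
  have h2 : 0 < Module.finrank k (LinearMap.ker (Linear.rightComp k P g)) :=
    Module.finrank_pos_iff_exists_ne_zero.2 ⟨⟨f, hfg⟩, fun h ↦ hf (congrArg Subtype.val h)⟩
  omega

variable {n : ℕ} {E : Fin n → D}

/-- The objects `X` with `Hom(E_j, X[m]) = 0` for all `j ≥ c` and all `m ∈ S`. -/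
def vanishFrom (E : Fin n → D) (S : Set ℤ) (c : ℕ) : ObjectProperty D :=
  fun X ↦ ∀ j : Fin n, c ≤ j.val → ∀ m ∈ S, HomVanishes (E j) X m

/-- The nonzero maps from shifts of `E_c` are coned off one at a time. Maps from `E_j` with `j > c`
do not reappear, because `Hom(E_j, E_c[*]) = 0`. -/
lemma vanishFrom_succ_le [IsTriangulated D] (hE : IsExceptionalCollection k E)
    (hfin : ∀ i, HomFiniteBounded k (E i)) (S : Set ℤ) (U : ObjectProperty D)
    [U.IsTriangulatedClosed₂] [U.IsClosedUnderIsomorphisms] [U.ContainsZero]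
    (hU : ∀ i, ∀ m ∈ S, U ((E i)⟦-m⟧)) (c : ℕ) (hc : c < n) :
    vanishFrom E S (c + 1) ≤ U.extensionProduct (vanishFrom E S c) := by
  set i : Fin n := ⟨c, hc⟩ with hi
  -- Induction on the total dimension `d` of `Hom(E_c, X[m])` over the window `|m| ≤ N`. The window
  -- stays fixed: outside it the groups with `m ∈ S` vanish, and coning preserves this.
  have key : ∀ (N d : ℕ) (X : D), vanishFrom E S (c + 1) X →
      (∀ m : ℤ, m ∈ S → N < |m| → HomVanishes (E i) X m) →
      ∑ m ∈ Finset.Icc (-N : ℤ) N, Module.finrank k (E i ⟶ X⟦m⟧) = d →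
      U.extensionProduct (vanishFrom E S c) X := by
    intro N d
    induction d using Nat.strong_induction_on with
    | _ d ih =>
    intro X hX hN hd
    by_cases h0 : ∀ m ∈ S, HomVanishes (E i) X m
    · refine ObjectProperty.le_extensionProduct_right (P := U) _ ?_
      intro j hj m hm
      rcases Nat.lt_or_ge c j.val with h | h
      · exact hX j h m hm
      · obtain rfl : j = i := Fin.ext (by simp [hi]; omega)
        exact h0 m hm
    · push Not at h0
      obtain ⟨m, hm, hmX⟩ := h0
      have hmN : m ∈ Finset.Icc (-N : ℤ) N := by
        rw [Finset.mem_Icc, ← abs_le]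
        by_contra h
        exact hmX (hN m hm (by omega))
      -- A nonzero element of `Hom(E_c, X[m])` is the same as a nonzero map `E_c[-m] → X`.
      have hmX' : ¬ ∀ f : (E i)⟦-m⟧ ⟶ X, f = 0 := by
        rwa [hom_shift_eq_zero_iff, neg_neg]
      push Not at hmX'
      obtain ⟨f, hf⟩ := hmX'
      obtain ⟨Y, g, h, hT⟩ := distinguished_cocone_triangle f
      have hlift := exists_lift_of_cone (hE.bijective_smul_id i).2
        (fun l hl ↦ hE.self_eq_zero i l hl) m hf hT
      have := (hfin i).finite
      have hvan : ∀ l, HomVanishes (E i) X l → HomVanishes (E i) Y l := by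
        intro l hl u
        obtain ⟨v, rfl⟩ := hlift l u
        rw [hl v, zero_comp]
      have hle := fun l ↦ finrank_hom_le_of_surjective (k := k) (g⟦l⟧') (hlift l)
      have hlt : Module.finrank k (E i ⟶ Y⟦m⟧) < Module.finrank k (E i ⟶ X⟦m⟧) := by
        refine finrank_hom_lt_of_surjective (k := k) (g⟦m⟧') (hlift m)
          ((shiftNegShift (E i) m).inv ≫ f⟦m⟧') ?_ ?_
        · intro h
          apply hf
          apply (shiftFunctor D m).map_injective
          rw [← cancel_epi (shiftNegShift (E i) m).inv, h, Functor.map_zero, comp_zero]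
        · rw [Category.assoc, ← Functor.map_comp]
          have : f ≫ g = 0 := comp_distTriang_mor_zero₁₂ _ hT
          rw [this, Functor.map_zero, comp_zero]
      have hY := ih _ (hd ▸ Finset.sum_lt_sum (fun l _ ↦ hle l) ⟨m, hmN, hlt⟩) Y
        (fun j hj l hl ↦ HomVanishes.obj₃ hT l (l + 1) rfl (hX j hj l hl)
          ((homVanishes_shift_right_iff _ _ _ rfl).2
            (hE.eq_zero_of_lt i j (Fin.lt_def.2 (by simp [hi]; omega)) _)))
        (fun l hl hlN ↦ hvan l (hN l hl hlN)) rfl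
      -- Extension products are associative and `U` is closed under extensions, so the two factors
      -- `U` merge into one.
      have hX' : U.extensionProduct (U.extensionProduct (vanishFrom E S c)) X :=
        ⟨_, _, f, g, h, hT, hU i m hm, hY⟩
      rw [← ObjectProperty.extensionProduct_assoc] at hX'
      exact ObjectProperty.monotone_extensionProduct_left _
        (ObjectProperty.extensionProduct_le_of_isTriangulatedClosed₂ le_rfl le_rfl) _ hX'
  intro X hX
  obtain ⟨N, hN⟩ := (hfin i).bounded X
  exact key N _ X hX (fun m _ ↦ hN m) rfl

/-- The condition `vanishFrom E S n` is empty, so every object satisfies it; `vanishFrom_succ_le`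
then lowers the bound from `n` to `0`. -/
lemma extensionProduct_vanishFrom_zero [IsTriangulated D] (hE : IsExceptionalCollection k E)
    (hfin : ∀ i, HomFiniteBounded k (E i)) (S : Set ℤ) (U : ObjectProperty D)
    [U.IsTriangulatedClosed₂] [U.IsClosedUnderIsomorphisms] [U.ContainsZero]
    (hU : ∀ i, ∀ m ∈ S, U ((E i)⟦-m⟧)) (X : D) :
    U.extensionProduct (vanishFrom E S 0) X := by
  have key : ∀ c ≤ n, vanishFrom E S c ≤ U.extensionProduct (vanishFrom E S 0) := by
    intro c
    induction c with
    | zero => exact fun _ ↦ ObjectProperty.le_extensionProduct_right _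
    | succ c ih =>
      intro hc X hX
      have h := ObjectProperty.monotone_extensionProduct_right _ (ih (by omega)) _
        (vanishFrom_succ_le hE hfin S U hU c hc X hX)
      rw [← ObjectProperty.extensionProduct_assoc] at h
      exact ObjectProperty.monotone_extensionProduct_left _
        (ObjectProperty.extensionProduct_le_of_isTriangulatedClosed₂ le_rfl le_rfl) _ h
  exact key n le_rfl X fun j hj ↦ absurd j.isLt (by omega)

/-- An exceptional collection such that only the zero object is orthogonal to it is complete. -/
lemma isCompleteCollection_of_generates [IsTriangulated D] (hE : IsExceptionalCollection k E)
    (hfin : ∀ i, HomFiniteBounded k (E i))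
    (hgen : ∀ X, (∀ i m, HomVanishes (E i) X m) → IsZero X) : IsCompleteCollection E := by
  intro P _ _ hP X
  obtain ⟨A, V, f, g, h, hT, hA, hV⟩ := extensionProduct_vanishFrom_zero hE hfin Set.univ P
    (fun i m _ ↦ P.le_shift (-m) _ (hP i)) X
  have hV0 : IsZero V := hgen V fun i m ↦ hV i (Nat.zero_le _) m trivial
  have : IsIso f := (Triangle.isZero₃_iff_isIso₁ _ hT).1 hV0
  exact P.prop_of_iso (asIso f) hA

/-! ### The t-structure of a strong exceptional collection -/

/-- The objects `X` with `Hom(E_i, X[m]) = 0` for all `i` and all `m > a`. -/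
def tiltLE (E : Fin n → D) (a : ℤ) : ObjectProperty D :=
  fun X ↦ ∀ i, ∀ m > a, HomVanishes (E i) X m

/-- The objects `X` with `Hom(E_i, X[m]) = 0` for all `i` and all `m < a`. -/
def tiltGE (E : Fin n → D) (a : ℤ) : ObjectProperty D :=
  fun X ↦ ∀ i, ∀ m < a, HomVanishes (E i) X m

instance (a : ℤ) : (tiltLE E a).IsClosedUnderIsomorphisms :=
  ⟨fun e h i m hm ↦ (h i m hm).of_iso (Iso.refl _) e⟩

instance (a : ℤ) : (tiltGE E a).IsClosedUnderIsomorphisms :=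
  ⟨fun e h i m hm ↦ (h i m hm).of_iso (Iso.refl _) e⟩

/-- Coning off in the degrees `m ≤ 0` uses only the pieces `E_i[-m]`, and these lie in `tiltLE E 0`
because the collection is strong. The class `U` records an extra property of the pieces: `⊤`
suffices for truncation, other choices give dévissage. -/
lemma tilt_exists_triangle [IsTriangulated D] (hE : IsExceptionalCollection k E)
    (hs : IsStrongCollection E)
    (hfin : ∀ i, HomFiniteBounded k (E i)) (U : ObjectProperty D)
    [U.IsTriangulatedClosed₂] [U.IsClosedUnderIsomorphisms] [U.ContainsZero]
    (hU : ∀ i, ∀ m : ℤ, 0 ≤ m → U ((E i)⟦m⟧)) (X : D) :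
    ∃ (A V : D) (_ : tiltLE E 0 A ∧ U A) (_ : tiltGE E 1 V) (f : A ⟶ X) (g : X ⟶ V)
      (h : V ⟶ A⟦(1 : ℤ)⟧), Triangle.mk f g h ∈ distTriang D := by
  have : (tiltLE E 0).IsTriangulatedClosed₂ :=
    .mk' fun T hT h₁ h₃ i m hm ↦ HomVanishes.obj₂ hT (h₁ i m hm) (h₃ i m hm)
  have : (tiltLE E 0 ⊓ U).IsTriangulatedClosed₂ :=
    .mk' fun T hT h₁ h₃ ↦ ⟨(tiltLE E 0).ext_of_isTriangulatedClosed₂ T hT h₁.1 h₃.1,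
      U.ext_of_isTriangulatedClosed₂ T hT h₁.2 h₃.2⟩
  have : (tiltLE E 0 ⊓ U).ContainsZero := by
    obtain ⟨Z, hZ, hZU⟩ := U.exists_prop_of_containsZero
    exact ⟨⟨Z, hZ, fun i m _ f ↦ ((shiftFunctor D m).map_isZero hZ).eq_of_tgt _ _, hZU⟩⟩
  obtain ⟨A, V, f, g, h, hT, hA, hV⟩ := extensionProduct_vanishFrom_zero hE hfin (Set.Iic 0)
    (tiltLE E 0 ⊓ U) (fun i m hm ↦ ⟨fun j l hl ↦ (homVanishes_shift_right_iff _ _ _ rfl).2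
      (hs j i _ (by rw [Set.mem_Iic] at hm; omega)), hU i (-m) (by rw [Set.mem_Iic] at hm; omega)⟩)
      X
  exact ⟨A, V, hA, fun i m hm ↦ hV i (Nat.zero_le _) m (by rw [Set.mem_Iic]; omega), f, g, h, hT⟩

/-- The lower half is built by extensions from the `E_i[m]` with `m ≥ 0`. In the truncation triangle
of such an `X` the third object has no maps from any shift of any `E_i`: in degrees `≤ 0` by
construction, in higher degrees because `X` and `A[1]` have none. So it is zero. -/
lemma tiltLE_induction [IsTriangulated D] (hE : IsExceptionalCollection k E)
    (hs : IsStrongCollection E) (hfin : ∀ i, HomFiniteBounded k (E i))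
    (hgen : ∀ X, (∀ i m, HomVanishes (E i) X m) → IsZero X) (U : ObjectProperty D)
    [U.IsTriangulatedClosed₂] [U.IsClosedUnderIsomorphisms] [U.ContainsZero]
    (hU : ∀ i, ∀ m : ℤ, 0 ≤ m → U ((E i)⟦m⟧)) : tiltLE E 0 ≤ U := by
  intro X hX
  obtain ⟨A, V, hA, hV, f, g, h, hT⟩ := tilt_exists_triangle hE hs hfin U hU X
  have hV0 : IsZero V := hgen V fun i m ↦ by
    rcases lt_or_ge m 1 with hm | hm
    · exact hV i m hm
    · exact HomVanishes.obj₃ hT m (m + 1) rfl (hX i m (by omega)) (hA.1 i (m + 1) (by omega))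
  have : IsIso f := (Triangle.isZero₃_iff_isIso₁ _ hT).1 hV0
  exact U.prop_of_iso (asIso f) hA.2

/-- Dévissage on `X`: the objects without maps to `Y` are closed under extensions and contain all
`E_i[m]` with `m ≥ 0`. -/
lemma hom_eq_zero_of_tiltLE_of_tiltGE [IsTriangulated D] (hE : IsExceptionalCollection k E)
    (hs : IsStrongCollection E) (hfin : ∀ i, HomFiniteBounded k (E i))
    (hgen : ∀ X, (∀ i m, HomVanishes (E i) X m) → IsZero X) {X Y : D} (hX : tiltLE E 0 X)
    (hY : tiltGE E 1 Y) (f : X ⟶ Y) : f = 0 := by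
  let U : ObjectProperty D := fun X ↦ HomVanishes X Y 0
  have : U.IsClosedUnderIsomorphisms := ⟨fun e h ↦ h.of_iso e (Iso.refl _)⟩
  have : U.IsTriangulatedClosed₂ := .mk' fun T hT h₁ h₃ ↦ HomVanishes.src_obj₂ hT h₁ h₃
  have : U.ContainsZero := ⟨⟨0, isZero_zero D, HomVanishes.of_isZero 0 (isZero_zero D)⟩⟩
  have h := tiltLE_induction hE hs hfin hgen U (fun i m hm ↦
    (homVanishes_shift_left_iff m 0 (-m) (by omega)).2 (hY i (-m) (by omega))) X hX
  exact homVanishes_zero_iff.1 h f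

/-- The t-structure of a strong exceptional collection. -/
def tiltTStructure [IsTriangulated D] (hE : IsExceptionalCollection k E)
    (hs : IsStrongCollection E) (hfin : ∀ i, HomFiniteBounded k (E i))
    (hgen : ∀ X, (∀ i m, HomVanishes (E i) X m) → IsZero X) : TStructure D where
  le a := tiltLE E a
  ge a := tiltGE E a
  le_shift a b c h X hX i m hm :=
    (homVanishes_shift_right_iff b m (b + m) rfl).2 (hX i _ (by omega))
  ge_shift a b c h X hX i m hm :=
    (homVanishes_shift_right_iff b m (b + m) rfl).2 (hX i _ (by omega))
  zero' _ _ f hX hY := hom_eq_zero_of_tiltLE_of_tiltGE hE hs hfin hgen hX hY f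
  le_zero_le X hX i m hm := hX i m (by omega)
  ge_one_le X hX i m hm := hX i m (by omega)
  exists_triangle_zero_one X := by
    have : (⊤ : ObjectProperty D).IsTriangulatedClosed₂ := .mk' fun _ _ _ _ ↦ trivial
    obtain ⟨A, V, hA, hV, f, g, h, hT⟩ := tilt_exists_triangle hE hs hfin ⊤
      (fun _ _ _ ↦ trivial) X
    exact ⟨A, V, hA.1, hV, f, g, h, hT⟩

/-- The upper half of a t-structure is the right orthogonal of the shifted lower half. -/
lemma ge_zero_iff_forall_hom_shift_eq_zero (t : TStructure D) (C : D) :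
    t.ge 0 C ↔ ∀ X, t.le 0 X → ∀ f : X⟦(1 : ℤ)⟧ ⟶ C, f = 0 := by
  constructor
  · intro hC X hX f
    have := t.le_shift 0 1 (-1) (by omega) X hX
    exact t.zero_of_isLE_of_isGE f (-1) 0 (by omega) ⟨this⟩ ⟨hC⟩
  · intro h
    obtain ⟨A, V, hA, hV, f, g, δ, hT⟩ := t.exists_triangle C (-1) 0 (by omega)
    -- `A` is the shift by 1 of `A[-1]`, which lies in `t.le 0`, so the hypothesis applies to `f`.
    have hf : f = 0 := hom_eq_zero_of_iso ((shiftShiftNeg A (-1 : ℤ) : _)) (Iso.refl C)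
      (fun f' ↦ h (A⟦(-1 : ℤ)⟧) (t.le_shift (-1) (-1) 0 (by omega) A hA) f') f
    have hid : 𝟙 A = 0 := by
      have h1 : (f : A ⟶ C)⟦(1 : ℤ)⟧' = 0 := by rw [hf, Functor.map_zero]
      -- As `f = 0`, the identity of `A[1]` factors through a map `A[1] → V`. This map goes from
      -- degrees `≤ -2` to degrees `≥ 0`, so it vanishes and `A = 0`.
      obtain ⟨s, hs⟩ := Triangle.coyoneda_exact₁ _ hT (𝟙 (A⟦(1 : ℤ)⟧)) ((congrArg _ h1).trans comp_zero)
      have hs0 : s = 0 := t.zero_of_isLE_of_isGE s (-2) 0 (by omega)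
        ⟨t.le_shift (-1) 1 (-2) (by omega) A hA⟩ ⟨hV⟩
      apply (shiftFunctor D (1 : ℤ)).map_injective
      rw [CategoryTheory.Functor.map_id, Functor.map_zero]
      exact hs.trans ((congrArg (· ≫ _) hs0).trans zero_comp)
    have : IsIso g := (Triangle.isZero₁_iff_isIso₂ _ hT).1 ((IsZero.iff_id_eq_zero A).2 hid)
    exact (t.ge 0).prop_of_iso (asIso g).symm hV

end Truncation

/-! ### The heart of the t-structure of a tilting object -/

section Tilting

variable {D : Type u} [Category.{v} D] [Preadditive D] [HasZeroObject D] [HasShift D ℤ]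
  [∀ m : ℤ, (shiftFunctor D m).Additive] [Pretriangulated D]

open Pretriangulated

lemma homVanishes_biproduct_left_iff {ι : Type} [Finite ι] (E : ι → D) (X : D) (m : ℤ) :
    HomVanishes (⨁ E) X m ↔ ∀ i, HomVanishes (E i) X m := by
  constructor
  · intro h i f
    have := biproduct.ι E i ≫= h (biproduct.π E i ≫ f)
    simpa using this
  · intro h f
    refine biproduct.hom_ext' _ _ fun i ↦ ?_
    rw [h i (biproduct.ι E i ≫ f), comp_zero]

lemma homVanishes_biproduct_right {ι : Type} [Fintype ι] (E : ι → D) (P : D) (m : ℤ)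
    (h : ∀ i, HomVanishes P (E i) m) : HomVanishes P (⨁ E) m := by
  intro f
  have h1 : f = f ≫ (𝟙 (⨁ E))⟦m⟧' := by simp
  rw [h1, ← biproduct.total, Functor.map_sum, Preadditive.comp_sum]
  refine Finset.sum_eq_zero fun i _ ↦ ?_
  rw [Functor.map_comp, ← Category.assoc, h i (f ≫ (biproduct.π E i)⟦m⟧'), zero_comp]

/-- `t` is the t-structure given by the tilting object `T`. -/
structure IsTiltingTStructure (t : TStructure D) (T : D) : Prop where
  le_iff (a : ℤ) (X : D) : t.le a X ↔ ∀ m > a, HomVanishes T X m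
  ge_iff (a : ℤ) (X : D) : t.ge a X ↔ ∀ m < a, HomVanishes T X m
  self (m : ℤ) (hm : m ≠ 0) : HomVanishes T T m

variable {t : TStructure D} {T : D}

lemma IsTiltingTStructure.heart_iff (ht : IsTiltingTStructure t T) (X : D) :
    t.heart X ↔ ∀ m ≠ 0, HomVanishes T X m := by
  rw [TStructure.heart]
  change t.le 0 X ∧ t.ge 0 X ↔ _
  rw [ht.le_iff, ht.ge_iff]
  exact ⟨fun h m hm ↦ (lt_or_gt_of_ne hm).elim (h.2 m) (h.1 m),
    fun h ↦ ⟨fun m hm ↦ h m hm.ne', fun m hm ↦ h m hm.ne⟩⟩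

lemma IsTiltingTStructure.hom_shift_eq_zero (_ : IsTiltingTStructure t T) {K Y : D}
    (hK : t.heart K) (hY : t.heart Y) (f : K⟦(1 : ℤ)⟧ ⟶ Y) : f = 0 :=
  t.zero_of_isLE_of_isGE f (-1) 0 (by omega) ⟨t.le_shift 0 1 (-1) (by omega) K hK.1⟩ ⟨hY.2⟩

variable (k : Type w) [Field k] [Linear k D]

omit [HasZeroObject D] [HasShift D ℤ] [∀ m : ℤ, (shiftFunctor D m).Additive]
  [Pretriangulated D] in
-- Packages a `k`-spanning family as one map from `T^r`. Finite dimension over `k` takes the place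
-- of a noetherian hypothesis on `End T`.
lemma exists_fin_spanning [HasFiniteBiproducts D] {X : D} (N : Submodule k (T ⟶ X))
    [Module.Finite k N] :
    ∃ (r : ℕ) (x : Fin r → (T ⟶ X)), (∀ i, x i ∈ N) ∧
      ∀ y ∈ N, ∃ c : Fin r → k, y = biproduct.lift (fun i ↦ c i • 𝟙 T) ≫ biproduct.desc x := by
  obtain ⟨r, s, hs⟩ := Module.Finite.exists_fin (R := k) (M := N)
  refine ⟨r, fun i ↦ s i, fun i ↦ (s i).2, fun y hy ↦ ?_⟩
  have : (⟨y, hy⟩ : N) ∈ Submodule.span k (Set.range s) := hs ▸ Submodule.mem_top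
  obtain ⟨c, hc⟩ := (Submodule.mem_span_range_iff_exists_fun k).1 this
  refine ⟨c, ?_⟩
  rw [biproduct.lift_desc]
  have := congrArg Subtype.val hc
  simpa using this.symm

/-- An endomorphism of `T`, as a scalar of the modules `Hom(T, X)`. -/
def opEnd (f : T ⟶ T) : (End T)ᵐᵒᵖ := MulOpposite.op f

omit [HasZeroObject D] [HasShift D ℤ] [∀ m : ℤ, (shiftFunctor D m).Additive]
  [Pretriangulated D] in
lemma opEnd_smul {X : D} (f : T ⟶ T) (h : T ⟶ X) : opEnd f • h = f ≫ h := rfl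

omit [HasZeroObject D] [HasShift D ℤ] [∀ m : ℤ, (shiftFunctor D m).Additive]
  [Pretriangulated D] in
lemma smul_eq_opEnd_smul {X : D} (c : k) (h : T ⟶ X) : c • h = opEnd (c • 𝟙 T) • h := by
  rw [opEnd_smul, Linear.smul_comp, Category.id_comp]

/-- Short exact sequences `0 → K → T^r → X → 0` in the heart. Surjectivity of `Hom(T, T^r) → Hom(T,
X)` is exactly what makes `Hom(T, K[1])` vanish; the other degrees follow from the long exact
sequence. -/
lemma IsTiltingTStructure.exists_cover (ht : IsTiltingTStructure t T)
    (hfin : ∀ X, Module.Finite k (T ⟶ X)) {X : D} (hX : t.heart X) :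
    ∃ (r : ℕ) (x : Fin r → (T ⟶ X)) (K : D) (ι : K ⟶ ⨁ fun _ : Fin r ↦ T)
      (δ : X ⟶ K⟦(1 : ℤ)⟧), Triangle.mk ι (biproduct.desc x) δ ∈ distTriang D ∧ t.heart K ∧
      ∀ y : T ⟶ X, ∃ z, y = z ≫ biproduct.desc x := by
  have := hfin X
  obtain ⟨r, x, -, hx⟩ := exists_fin_spanning (T := T) k (⊤ : Submodule k (T ⟶ X))
  obtain ⟨K, ι, δ, hT⟩ := distinguished_cocone_triangle₁ (biproduct.desc x)
  have hx' : ∀ y : T ⟶ X, ∃ z, y = z ≫ biproduct.desc x := fun y ↦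
    (hx y trivial).imp' _ fun _ h ↦ h
  refine ⟨r, x, K, ι, δ, hT, ?_, hx'⟩
  have hP : ∀ m ≠ 0, HomVanishes T (⨁ fun _ : Fin r ↦ T) m := fun m hm ↦
    homVanishes_biproduct_right _ _ _ fun _ ↦ ht.self m hm
  rw [ht.heart_iff] at hX ⊢
  intro m hm
  by_cases hm1 : m = 1
  · subst hm1
    intro u
    obtain ⟨v, rfl⟩ := Triangle.coyoneda_exact₁ _ hT u (hP 1 one_ne_zero _)
    obtain ⟨z, rfl⟩ := hx' v
    have : biproduct.desc x ≫ δ = 0 := comp_distTriang_mor_zero₂₃ _ hT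
    change (z ≫ biproduct.desc x) ≫ δ = 0
    rw [Category.assoc, this, comp_zero]
  · exact HomVanishes.obj₁ hT (m - 1) m (by omega) (hX _ (by omega)) (hP m hm)

/-- A map killed by `Hom(T, -)` vanishes on the cover `T^r`, so it factors through `K[1]`, and heart
objects have no Ext in degree -1. -/
lemma IsTiltingTStructure.faithful (ht : IsTiltingTStructure t T)
    (hfin : ∀ X, Module.Finite k (T ⟶ X)) {X Y : D} (hX : t.heart X) (hY : t.heart Y)
    (g : X ⟶ Y) (hg : ∀ x : T ⟶ X, x ≫ g = 0) : g = 0 := by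
  obtain ⟨r, x, K, ι, δ, hT, hK, -⟩ := ht.exists_cover k hfin hX
  obtain ⟨s, hs⟩ := Triangle.yoneda_exact₃ _ hT g (biproduct.hom_ext' _ _ fun i ↦ by
    exact ((biproduct.ι_desc_assoc x i g).trans (hg (x i))).trans comp_zero.symm)
  rw [hs, ht.hom_shift_eq_zero hK hY s]
  exact comp_zero

/-- The images of the generators under `φ` define a map `T^r → Y`. By faithfulness it kills `K`,
hence descends to `X`. -/
lemma IsTiltingTStructure.full (ht : IsTiltingTStructure t T)
    (hfin : ∀ X, Module.Finite k (T ⟶ X)) {X Y : D} (hX : t.heart X) (hY : t.heart Y)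
    (φ : (T ⟶ X) →ₗ[(End T)ᵐᵒᵖ] (T ⟶ Y)) : ∃ g : X ⟶ Y, ∀ x, φ x = x ≫ g := by
  obtain ⟨r, x, K, ι, δ, hT, hK, hx⟩ := ht.exists_cover k hfin hX
  have hφ : ∀ h : T ⟶ ⨁ fun _ : Fin r ↦ T,
      φ (h ≫ biproduct.desc x) = h ≫ biproduct.desc fun i ↦ φ (x i) := by
    intro h
    rw [biproduct.desc_eq, biproduct.desc_eq, Preadditive.comp_sum, Preadditive.comp_sum, map_sum]
    refine Finset.sum_congr rfl fun i _ ↦ ?_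
    rw [← Category.assoc, ← Category.assoc]
    exact φ.map_smul (opEnd (h ≫ biproduct.π (fun _ : Fin r ↦ T) i)) (x i)
  have h0 : ι ≫ biproduct.desc (fun i ↦ φ (x i)) = 0 := by
    refine ht.faithful k hfin hK hY _ fun y ↦ ?_
    have : ι ≫ biproduct.desc x = 0 := comp_distTriang_mor_zero₁₂ _ hT
    rw [← Category.assoc, ← hφ, Category.assoc, this, comp_zero, map_zero]
  obtain ⟨g, hg⟩ := Triangle.yoneda_exact₂ _ hT _ h0
  refine ⟨g, fun y ↦ ?_⟩
  obtain ⟨z, rfl⟩ := hx y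
  exact (hφ z).trans ((congrArg (z ≫ ·) hg).trans (Category.assoc _ _ _).symm)

/-- A presentation of `M` lifts to a map `T^s → T^r`. The required object is the upper truncation of
its cone, that is, the cokernel in the heart. -/
lemma IsTiltingTStructure.exists_linearEquiv (ht : IsTiltingTStructure t T)
    (hfin : ∀ X, Module.Finite k (T ⟶ X)) (M : Type v) [AddCommGroup M] [Module (End T)ᵐᵒᵖ M]
    [Module.Finite (End T)ᵐᵒᵖ M] :
    ∃ V : D, t.heart V ∧ Nonempty ((T ⟶ V) ≃ₗ[(End T)ᵐᵒᵖ] M) := by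
  obtain ⟨r, m, hm⟩ := Module.Finite.exists_fin (R := (End T)ᵐᵒᵖ) (M := M)
  let P := ⨁ fun _ : Fin r ↦ T
  let p : (T ⟶ P) →ₗ[(End T)ᵐᵒᵖ] M :=
    { toFun := fun h ↦ ∑ i, opEnd (h ≫ biproduct.π (fun _ : Fin r ↦ T) i) • m i
      map_add' := fun f g ↦ by
        rw [← Finset.sum_add_distrib]
        refine Finset.sum_congr rfl fun i _ ↦ ?_
        rw [← add_smul, Preadditive.add_comp]
        rfl
      map_smul' := fun a f ↦ by
        rw [RingHom.id_apply, Finset.smul_sum]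
        refine Finset.sum_congr rfl fun i _ ↦ ?_
        rw [smul_smul]
        congr 1
        exact congrArg MulOpposite.op (Category.assoc a.unop f _) }
  have hpsurj : Function.Surjective p := by
    intro y
    have : y ∈ Submodule.span (End T)ᵐᵒᵖ (Set.range m) := hm ▸ Submodule.mem_top
    obtain ⟨c, hc⟩ := (Submodule.mem_span_range_iff_exists_fun _).1 this
    refine ⟨biproduct.lift fun i ↦ (c i).unop, ?_⟩
    rw [← hc]
    change ∑ i, opEnd _ • m i = _
    refine Finset.sum_congr rfl fun i _ ↦ ?_
    rw [biproduct.lift_π]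
    rfl
  let N : Submodule k (T ⟶ P) :=
    { carrier := {h | p h = 0}
      add_mem' := fun {f g} hf hg ↦ by
        change p (f + g) = 0
        rw [map_add, show p f = 0 from hf, show p g = 0 from hg, add_zero]
      zero_mem' := map_zero p
      smul_mem' := fun c f hf ↦ by
        change p (c • f) = 0
        rw [smul_eq_opEnd_smul, map_smul, show p f = 0 from hf, smul_zero] }
  have := hfin P
  obtain ⟨s, g, hgN, hg⟩ := exists_fin_spanning (T := T) k N
  have hgN' : ∀ w : T ⟶ ⨁ fun _ : Fin s ↦ T, p (w ≫ biproduct.desc g) = 0 := by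
    intro w
    rw [biproduct.desc_eq, Preadditive.comp_sum, map_sum]
    refine Finset.sum_eq_zero fun i _ ↦ ?_
    rw [← Category.assoc]
    refine (p.map_smul (opEnd (w ≫ biproduct.π (fun _ : Fin s ↦ T) i))
      (g i)).trans ?_
    rw [show p (g i) = 0 from hgN i, smul_zero]
  obtain ⟨C, ρ, δ, hT⟩ := distinguished_cocone_triangle (biproduct.desc g)
  have hP : ∀ (r : ℕ), ∀ m ≠ 0, HomVanishes T (⨁ fun _ : Fin r ↦ T) m := fun r m hm ↦
    homVanishes_biproduct_right _ _ _ fun _ ↦ ht.self m hm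
  -- The cone `C` has no maps from `T` in positive degrees, but it may have some in degree -1.
  -- Truncation removes those and keeps `Hom(T, C)`, since `Hom(T, U)` and `Hom(T, U[1])` vanish.
  obtain ⟨U, V, hU, hV, a, b, ε, hT'⟩ := t.exists_triangle C (-1) 0 (by omega)
  rw [ht.le_iff] at hU
  rw [ht.ge_iff] at hV
  have hVheart : t.heart V := by
    rw [ht.heart_iff]
    intro m hm
    rcases lt_or_gt_of_ne hm with hm | hm
    · exact hV m hm
    · refine HomVanishes.obj₃ hT' m (m + 1) rfl ?_ (hU _ (by omega))
      exact HomVanishes.obj₃ hT m (m + 1) rfl (hP r _ (by omega)) (hP s _ (by omega))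
  refine ⟨V, hVheart, ?_⟩
  let q : (T ⟶ P) →ₗ[(End T)ᵐᵒᵖ] (T ⟶ V) :=
    { toFun := fun h ↦ h ≫ ρ ≫ b
      map_add' := fun f g ↦ Preadditive.add_comp _ _ _ _ _ _
      map_smul' := fun a f ↦ Category.assoc _ _ _ }
  have hqsurj : Function.Surjective q := by
    intro y
    obtain ⟨z, rfl⟩ := Triangle.coyoneda_exact₃ _ hT' y (hU 1 (by omega) _)
    obtain ⟨h, rfl⟩ := Triangle.coyoneda_exact₃ _ hT z (hP s 1 one_ne_zero _)
    exact ⟨h, (Category.assoc _ _ _).symm⟩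
  have hker : LinearMap.ker q = LinearMap.ker p := by
    ext h
    rw [LinearMap.mem_ker, LinearMap.mem_ker]
    constructor
    · intro hq
      have h1 : (h ≫ ρ) ≫ b = 0 := (Category.assoc _ _ _).trans hq
      obtain ⟨z, hz⟩ := Triangle.coyoneda_exact₂ _ hT' _ h1
      have hz0 : z = 0 := homVanishes_zero_iff.1 (hU 0 (by omega)) z
      have h2 : h ≫ ρ = 0 := hz.trans ((congrArg (· ≫ a) hz0).trans zero_comp)
      obtain ⟨w, rfl⟩ := Triangle.coyoneda_exact₂ _ hT _ h2
      exact hgN' w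
    · intro hp
      obtain ⟨c, rfl⟩ := hg h hp
      have : biproduct.desc g ≫ ρ = 0 := comp_distTriang_mor_zero₁₂ _ hT
      change (_ ≫ biproduct.desc g) ≫ ρ ≫ b = 0
      rw [Category.assoc, reassoc_of% this, zero_comp, comp_zero]
  exact ⟨(q.quotKerEquivOfSurjective hqsurj).symm.trans
    ((Submodule.quotEquivOfEq _ _ hker).trans (p.quotKerEquivOfSurjective hpsurj))⟩

omit [HasZeroObject D] [HasShift D ℤ] [∀ m : ℤ, (shiftFunctor D m).Additive]
  [Pretriangulated D] in
lemma finite_coyoneda (X : D) [Module.Finite k (T ⟶ X)] :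
    Module.Finite (End T)ᵐᵒᵖ (T ⟶ X) := by
  obtain ⟨r, s, hs⟩ := Module.Finite.exists_fin (R := k) (M := T ⟶ X)
  classical
  refine ⟨⟨Finset.univ.image s, ?_⟩⟩
  rw [Finset.coe_image, Finset.coe_univ, Set.image_univ, eq_top_iff]
  intro y _
  have : y ∈ Submodule.span k (Set.range s) := hs ▸ Submodule.mem_top
  obtain ⟨c, rfl⟩ := (Submodule.mem_span_range_iff_exists_fun _).1 this
  refine Submodule.sum_mem _ fun i _ ↦ ?_
  rw [smul_eq_opEnd_smul]
  exact Submodule.smul_mem _ _ (Submodule.subset_span ⟨i, rfl⟩)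

/-- The functor `Hom(T, -)` from the heart to the finitely generated modules over `End T`. -/
noncomputable def heartToFGModule (t : TStructure D) (hfin : ∀ X, Module.Finite k (T ⟶ X)) :
    t.heart.FullSubcategory ⥤ FGModuleCat.{v} (End T)ᵐᵒᵖ :=
  (ModuleCat.isFG.{v} (End T)ᵐᵒᵖ).lift (t.heart.ι ⋙ preadditiveCoyonedaObj T) fun X ↦
    have := hfin X.obj
    finite_coyoneda k X.obj

lemma IsTiltingTStructure.isEquivalence (ht : IsTiltingTStructure t T)
    (hfin : ∀ X, Module.Finite k (T ⟶ X)) : (heartToFGModule k t hfin).IsEquivalence where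
  faithful := ⟨fun {X Y f g} h ↦ by
    have h1 : ∀ x : T ⟶ X.obj, x ≫ (f.hom - g.hom) = 0 := fun x ↦ by
      rw [Preadditive.comp_sub, sub_eq_zero]
      exact congrArg (fun φ : (heartToFGModule k t hfin).obj X ⟶ (heartToFGModule k t hfin).obj Y ↦
        φ.hom.hom x) h
    exact ObjectProperty.hom_ext _ (sub_eq_zero.1 (ht.faithful k hfin X.2 Y.2 _ h1))⟩
  full := ⟨fun {X Y} φ ↦ by
    obtain ⟨g, hg⟩ := ht.full k hfin X.2 Y.2 φ.hom.hom
    refine ⟨ObjectProperty.homMk g, ?_⟩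
    refine FGModuleCat.hom_ext (LinearMap.ext fun x ↦ (hg x).symm)⟩
  essSurj := ⟨fun M ↦ by
    obtain ⟨V, hV, ⟨e⟩⟩ := ht.exists_linearEquiv k hfin M
    have := hfin V
    have := finite_coyoneda (T := T) k V
    exact ⟨⟨V, hV⟩, ⟨e.toFGModuleCatIso⟩⟩⟩

omit [HasZeroObject D] [Pretriangulated D] in
/-- If `Hom(T, T[m]) = 0` for `m ≠ 0`, then `Ext^*(T, T) = End T`. -/
lemma nonempty_extAlgebra_ringEquiv (h : ∀ m ≠ 0, HomVanishes T T m) :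
    Nonempty (ExtAlgebra T ≃+* End T) := by
  let f : End T →+* ExtAlgebra T :=
    { toFun := fun f ↦ DirectSum.of (SelfExt T) 0 (ShiftedHom.mk₀ 0 rfl f)
      map_one' := rfl
      map_mul' := fun f g ↦ by
        rw [DirectSum.of_mul_of]
        exact congrArg _ (ShiftedHom.mk₀_comp_mk₀ g f (add_zero 0) rfl rfl).symm
      map_zero' := by rw [ShiftedHom.mk₀_zero, map_zero]
      map_add' := fun f g ↦ by rw [ShiftedHom.mk₀_add, map_add] }
  refine ⟨(RingEquiv.ofBijective f ⟨fun a b hab ↦ ?_, fun x ↦ ?_⟩).symm⟩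
  · exact (ShiftedHom.homEquiv (0 : ℤ) rfl).injective (DirectSum.of_injective _ hab)
  · induction x using DirectSum.induction_on with
    | zero => exact ⟨0, map_zero f⟩
    | of m x =>
      by_cases hm : m = 0
      · subst hm
        obtain ⟨y, rfl⟩ := (ShiftedHom.homEquiv (0 : ℤ) rfl).surjective x
        exact ⟨y, rfl⟩
      · exact ⟨0, by rw [map_zero, h m hm x, map_zero]⟩
    | add x y hx hy =>
      obtain ⟨a, rfl⟩ := hx
      obtain ⟨b, rfl⟩ := hy
      exact ⟨a + b, map_add f a b⟩

/-- Isomorphic rings have equivalent categories of finitely generated modules. -/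
lemma nonempty_FGModuleCat_equivalence {R S : Type v} [Ring R] [Ring S] (e : R ≃+* S) :
    Nonempty (FGModuleCat.{v} S ≌ FGModuleCat.{v} R) := by
  have : (ModuleCat.isFG.{v} R).IsClosedUnderIsomorphisms :=
    ⟨fun i (h : Module.Finite R _) ↦ Module.Finite.equiv i.toLinearEquiv⟩
  refine ⟨(ModuleCat.restrictScalarsEquivalenceOfRingEquiv e).congrFullSubcategory ?_⟩
  ext M
  let N := (ModuleCat.restrictScalars e.toRingHom).obj M
  have : RingHomSurjective (e : R →+* S) := ⟨e.surjective⟩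
  have : RingHomSurjective (e.symm : S →+* R) := ⟨e.symm.surjective⟩
  -- The identity map is semilinear over `e` and, backwards, over `e.symm`; this carries finite
  -- generation both ways.
  let f : N →ₛₗ[(e : R →+* S)] M :=
    { toFun := fun x ↦ x
      map_add' := fun _ _ ↦ rfl
      map_smul' := fun _ _ ↦ rfl }
  let g : M →ₛₗ[(e.symm : S →+* R)] N :=
    { toFun := fun x ↦ x
      map_add' := fun _ _ ↦ rfl
      map_smul' := fun r x ↦ (congrArg (· • (show M from x)) (e.apply_symm_apply r)).symm }
  change Module.Finite R N ↔ Module.Finite S M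
  exact ⟨fun _ ↦ Module.Finite.of_surjective f fun x ↦ ⟨x, rfl⟩,
    fun _ ↦ Module.Finite.of_surjective g fun x ↦ ⟨x, rfl⟩⟩

lemma IsTiltingTStructure.nonempty_heart_equivalence (ht : IsTiltingTStructure t T)
    (hfin : ∀ X, Module.Finite k (T ⟶ X)) :
    Nonempty (t.heart.FullSubcategory ≌ FGModuleCat.{v} (ExtAlgebra T)ᵐᵒᵖ) := by
  have := ht.isEquivalence k hfin
  obtain ⟨e⟩ := nonempty_extAlgebra_ringEquiv ht.self
  obtain ⟨F⟩ := nonempty_FGModuleCat_equivalence (RingEquiv.op e)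
  exact ⟨(heartToFGModule k t hfin).asEquivalence.trans F⟩

end Tilting

/-! ### Morphisms from projective objects in derived categories -/

section DerivedProjective

open DerivedCategory Pretriangulated

variable {C : Type u} [Category.{v} C] [Abelian C] [HasDerivedCategory.{w} C]

omit [HasDerivedCategory.{w} C] in
lemma isKProjective_single (P : C) [Projective P] :
    ((CochainComplex.singleFunctor C 0).obj P).IsKProjective := by
  have (n : ℤ) : Projective (((CochainComplex.singleFunctor C 0).obj P).X n) := by
    by_cases hn : n = 0
    · subst hn
      exact Projective.of_iso
        (HomologicalComplex.singleObjXSelf (ComplexShape.up ℤ) (0 : ℤ) P).symm inferInstance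
    · exact (HomologicalComplex.isZero_single_obj_X (ComplexShape.up ℤ) 0 P n hn).projective
  have : ((CochainComplex.singleFunctor C 0).obj P).IsStrictlyLE 0 :=
    inferInstanceAs (CochainComplex.IsStrictlyLE
      ((HomologicalComplex.single C (ComplexShape.up ℤ) 0).obj P) 0)
  exact CochainComplex.isKProjective_of_projective _ 0

/-- `X` is represented by a complex in degrees `≤ -1`. Maps out of a K-projective complex come from
chain maps, and a chain map from degree 0 to such a complex is zero. -/
lemma single_hom_eq_zero_of_isLE (P : C) [Projective P] (X : DerivedCategory C)
    [X.IsLE (-1)] (f : (singleFunctor C 0).obj P ⟶ X) : f = 0 := by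
  obtain ⟨L, _, ⟨e⟩⟩ := exists_iso_Q_obj_of_isLE X (-1)
  have := isKProjective_single P
  suffices ∀ g : (singleFunctor C 0).obj P ⟶ Q.obj L, g = 0 from
    hom_eq_zero_of_iso (Iso.refl _) e.symm this f
  intro g
  obtain ⟨g', rfl⟩ := (CochainComplex.IsKProjective.Qh_map_bijective
    ((CochainComplex.singleFunctor C 0).obj P) ((HomotopyCategory.quotient _ _).obj L)).2 g
  obtain ⟨g', rfl⟩ := (HomotopyCategory.quotient _ _).map_surjective g'
  have : g' = 0 := by
    ext i
    by_cases hi : i = 0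
    · exact (L.isZero_of_isStrictlyLE (-1) i (by omega)).eq_of_tgt _ _
    · exact (HomologicalComplex.isZero_single_obj_X (ComplexShape.up ℤ) 0 P i hi).eq_of_src _ _
  rw [this, Functor.map_zero]
  exact Functor.map_zero _ _ _

lemma single_hom_eq_zero_of_isGE (P : C) (X : DerivedCategory C)
    [X.IsGE 1] (f : (singleFunctor C 0).obj P ⟶ X) : f = 0 :=
  TStructure.t.zero f 0 1

lemma homVanishes_single_of_isLE (P : C) [Projective P] (X : DerivedCategory C) (b m : ℤ)
    (h : b < m) [X.IsLE b] : HomVanishes ((singleFunctor C 0).obj P) X m := fun f ↦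
  have : (X⟦m⟧).IsLE (b - m) := TStructure.t.isLE_shift X b m (b - m)
  have : (X⟦m⟧).IsLE (-1) := TStructure.t.isLE_of_le _ (b - m) (-1)
  single_hom_eq_zero_of_isLE P _ f

lemma homVanishes_single_of_isGE (P : C) (X : DerivedCategory C) (a m : ℤ)
    (h : m < a) [X.IsGE a] : HomVanishes ((singleFunctor C 0).obj P) X m := fun f ↦
  have : (X⟦m⟧).IsGE (a - m) := TStructure.t.isGE_shift X a m (a - m)
  have : (X⟦m⟧).IsGE 1 := TStructure.t.isGE_of_ge _ 1 (a - m)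
  single_hom_eq_zero_of_isGE P _ f

section

variable (k : Type*) [Field k] [Linear k C]

/-- Two truncations reduce `X` to its cohomology in degree 0, where full faithfulness of the
embedding gives `Hom(P, M)`. -/
lemma finite_single_hom (P : C) [Projective P] (hP : ∀ M : C, Module.Finite k (P ⟶ M))
    (X : DerivedCategory C) : Module.Finite k ((singleFunctor C 0).obj P ⟶ X) := by
  have hzero : ∀ Y : DerivedCategory C, (∀ f : (singleFunctor C 0).obj P ⟶ Y, f = 0) →
      Module.Finite k ((singleFunctor C 0).obj P ⟶ Y) := fun Y h ↦
    have : Subsingleton ((singleFunctor C 0).obj P ⟶ Y) := ⟨fun f g ↦ (h f).trans (h g).symm⟩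
    inferInstance
  obtain ⟨A, Y, hA, hY, f, g, h, hT⟩ := TStructure.t.exists_triangle X (-1) 0 (by omega)
  refine finite_hom_obj₂ k hT (hzero A fun f ↦ ?_) ?_
  · have : A.IsLE (-1) := ⟨hA⟩
    exact single_hom_eq_zero_of_isLE P A f
  change Module.Finite k ((singleFunctor C 0).obj P ⟶ Y)
  obtain ⟨B, Z, hB, hZ, f', g', h', hT'⟩ := TStructure.t.exists_triangle Y 0 1 (by omega)
  refine finite_hom_obj₂ k hT' ?_ (hzero Z fun f ↦ ?_)
  · change Module.Finite k ((singleFunctor C 0).obj P ⟶ B)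
    have : B.IsLE 0 := ⟨hB⟩
    have : Z.IsGE 1 := ⟨hZ⟩
    -- `B` is an extension of `Z[-1]` and `Y`, both in degrees `≥ 0`, so `B` is concentrated in
    -- degree 0.
    have : (Z⟦(-1 : ℤ)⟧).IsGE 2 := TStructure.t.isGE_shift Z 1 (-1) 2
    have h0 : (Z⟦(-1 : ℤ)⟧).IsGE 0 := TStructure.t.isGE_of_ge _ 0 2
    have : B.IsGE 0 := TStructure.t.isGE₂ _ (inv_rot_of_distTriang _ hT') 0 h0 ⟨hY⟩
    obtain ⟨M, ⟨e⟩⟩ := exists_iso_singleFunctor_obj_of_isGE_of_isLE B 0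
    have := hP M
    have : Module.Finite k ((singleFunctor C 0).obj P ⟶ (singleFunctor C 0).obj M) :=
      Module.Finite.of_surjective ((singleFunctor C 0).mapLinearMap k)
        (singleFunctor C 0).map_surjective
    exact finite_hom_of_iso k (Iso.refl _) e.symm this
  · have : Z.IsGE 1 := ⟨hZ⟩
    exact single_hom_eq_zero_of_isGE P Z f

end

/-- The projective objects `P_i` detect zero objects in the bounded derived category if they do so
in the abelian category. -/
lemma isZero_of_homVanishes_single {ι : Type*} (P : ι → C) [∀ i, Projective (P i)]
    (hP : ∀ M : C, (∀ (i : ι) (f : P i ⟶ M), f = 0) → IsZero M) (X : DerivedCategory C)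
    (a b : ℤ) [X.IsGE a] [X.IsLE b]
    (hX : ∀ i m, HomVanishes ((singleFunctor C 0).obj (P i)) X m) : IsZero X := by
  -- The top cohomology `M` of `X` vanishes: `Hom(P_i, M) = Hom(P_i, Y[b])` sits between `Hom(P_i,
  -- X[b])` and `Hom(P_i, A[b+1])`, both zero. Iterating pushes `X` below its lower bound `a`.
  have step : ∀ b : ℤ, X.IsLE b → X.IsLE (b - 1) := by
    intro b _
    obtain ⟨A, Y, hA, hY, f, g, h, hT⟩ := TStructure.t.exists_triangle X (b - 1) b (by omega)
    have : A.IsLE (b - 1) := ⟨hA⟩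
    have : Y.IsGE b := ⟨hY⟩
    have : (A⟦(1 : ℤ)⟧).IsLE (b - 2) := TStructure.t.isLE_shift A (b - 1) 1 (b - 2)
    have h2 : (A⟦(1 : ℤ)⟧).IsLE b := TStructure.t.isLE_of_le _ (b - 2) b
    have : Y.IsLE b := TStructure.t.isLE₂ _ (rot_of_distTriang _ hT) b ‹_› h2
    obtain ⟨M, ⟨e⟩⟩ := exists_iso_singleFunctor_obj_of_isGE_of_isLE Y b
    have hM : IsZero M := hP M fun i φ ↦ by
      have h1 : HomVanishes ((singleFunctor C 0).obj (P i)) Y b :=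
        HomVanishes.obj₃ hT b (b + 1) rfl (hX i b)
          (homVanishes_single_of_isLE (P i) A (b - 1) (b + 1) (by omega))
      apply (singleFunctor C 0).map_injective
      rw [Functor.map_zero]
      exact hom_eq_zero_of_iso (Iso.refl _) ((shiftFunctor _ b).mapIso e ≪≫
        ((singleFunctors C).shiftIso b 0 b (by omega)).app M) h1 _
    have hY : IsZero Y := ((singleFunctor C b).map_isZero hM).of_iso e
    have : IsIso f := (Triangle.isZero₃_iff_isIso₁ _ hT).1 hY
    exact TStructure.t.isLE_of_iso (asIso f) (b - 1)
  have : X.IsLE (a - 1) := by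
    have key : ∀ m : ℕ, X.IsLE (b - m) := by
      intro m
      induction m with
      | zero => simpa
      | succ m ih =>
        have := step _ ih
        rwa [sub_sub] at this
    have := key (b - (a - 1)).toNat
    exact TStructure.t.isLE_of_le X (b - (b - (a - 1)).toNat) (a - 1)
  exact TStructure.t.isZero X (a - 1) a

end DerivedProjective

/-! ### The projective modules of a path algebra -/

namespace PathAlgebra

variable (k : Type u) {V : Type} [Field k] [Quiver.{0} V] [DecidableEq V] [Fintype V]

/-- The object of the category of finitely generated right modules given by `P_v`. -/
noncomputable abbrev projObj (v : V) : RightMod.{u} (PathAlgebra k V) :=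
  FGModuleCat.of _ (proj k v)

/-- The generator `e_v` of `P_v`. -/
noncomputable def projGen (v : V) : projObj k v := ⟨vertex k v, vertex_mem_proj k v⟩

lemma op_smul_projGen {v : V} (x : projObj k v) : MulOpposite.op x.1 • projGen k v = x :=
  Subtype.ext x.2

lemma apply_eq_op_smul {v : V} {M : RightMod.{u} (PathAlgebra k V)} (f : projObj k v ⟶ M)
    (x : projObj k v) : f.hom.hom x = MulOpposite.op x.1 • f.hom.hom (projGen k v) := by
  conv_lhs => rw [← op_smul_projGen k x]
  exact f.hom.hom.map_smul _ _

lemma projObj_hom_ext {v : V} {M : RightMod.{u} (PathAlgebra k V)} {f g : projObj k v ⟶ M}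
    (h : f.hom.hom (projGen k v) = g.hom.hom (projGen k v)) : f = g :=
  FGModuleCat.hom_ext (LinearMap.ext fun x ↦ by
    rw [apply_eq_op_smul k f x, apply_eq_op_smul k g x, h])

/-- The map `P_v ⟶ M`, `x ↦ m x`. -/
noncomputable def projDesc (v : V) {M : RightMod.{u} (PathAlgebra k V)} (m : M) :
    projObj k v ⟶ M :=
  FGModuleCat.ofHom (W := M)
    { toFun := fun x ↦ MulOpposite.op x.1 • m
      map_add' := fun x y ↦ by
        rw [Submodule.coe_add, MulOpposite.op_add, add_smul]
      map_smul' := fun r x ↦ by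
        rw [RingHom.id_apply, smul_smul]
        rfl }

/-- Every `m` is the sum of the `m e_v`, and `m e_v` is the image of `e_v` under `projDesc k v m`.
-/
lemma isZero_of_forall_projObj_hom (M : RightMod.{u} (PathAlgebra k V))
    (h : ∀ (v : V) (f : projObj k v ⟶ M), f = 0) : IsZero M := by
  have hM : ∀ m : M, m = 0 := fun m ↦ by
    have h1 : ∀ v, MulOpposite.op (vertex k v) • m = 0 := fun v ↦
      congrArg (fun f : projObj k v ⟶ M ↦ f.hom.hom (projGen k v)) (h v (projDesc k v m))
    rw [← one_smul (PathAlgebra k V)ᵐᵒᵖ m, ← MulOpposite.op_one, one_eq, Finset.op_sum,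
      Finset.sum_smul]
    exact Finset.sum_eq_zero fun v _ ↦ h1 v
  rw [IsZero.iff_id_eq_zero]
  exact FGModuleCat.hom_ext (LinearMap.ext fun m ↦ hM _)

/-- A lift of `f(e_v)` to `m` defines `x ↦ m x`. It sends `e_v` to `m e_v`, which still maps to
`f(e_v)` because `e_v` is idempotent. -/
instance [IsNoetherianRing (PathAlgebra k V)ᵐᵒᵖ] (v : V) : Projective (projObj k v) where
  factors {M N} f e _ := by
    have he : Function.Surjective e.hom.hom :=
      (ModuleCat.epi_iff_surjective _).1
        (inferInstanceAs (Epi ((forget₂ (FGModuleCat.{u} (PathAlgebra k V)ᵐᵒᵖ)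
          (ModuleCat.{u} (PathAlgebra k V)ᵐᵒᵖ)).map e)))
    obtain ⟨m, hm⟩ := he (f.hom.hom (projGen k v))
    refine ⟨projDesc k v m, projObj_hom_ext k ?_⟩
    change e.hom.hom (MulOpposite.op (vertex k v) • m) = _
    rw [map_smul, hm]
    exact (apply_eq_op_smul k f (projGen k v)).symm

lemma finite_projObj_hom [Module.Finite k (PathAlgebra k V)ᵐᵒᵖ] (v : V)
    (M : RightMod.{u} (PathAlgebra k V)) : Module.Finite k (projObj k v ⟶ M) := by
  let _ : Module k M := Module.restrictScalars k (PathAlgebra k V)ᵐᵒᵖ M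
  have : IsScalarTower k (PathAlgebra k V)ᵐᵒᵖ M :=
    IsScalarTower.restrictScalars k (PathAlgebra k V)ᵐᵒᵖ M
  have : Module.Finite k M := Module.Finite.trans (PathAlgebra k V)ᵐᵒᵖ M
  let ev : (projObj k v ⟶ M) →ₗ[k] M :=
    { toFun := fun f ↦ f.hom.hom (projGen k v)
      map_add' := fun _ _ ↦ rfl
      map_smul' := fun _ _ ↦ rfl }
  exact Module.Finite.of_injective ev fun f g h ↦ projObj_hom_ext k h

lemma vertex_mul_mul_vertex_mem_span (a b : V) (x : PathAlgebra k V) :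
    vertex k b * x * vertex k a ∈
      Submodule.span k (Set.range fun p : Quiver.Path a b ↦ ofPath k p) := by
  induction x using induction_paths with
  | zero => simp
  | add x y hx hy => rw [mul_add, add_mul]; exact Submodule.add_mem _ hx hy
  | smul_path r c d p =>
    rw [mul_smul', smul_mul']
    refine Submodule.smul_mem _ _ ?_
    by_cases hd : d = b
    · subst hd
      rw [vertex, ofPath_mul_comp, Quiver.Path.comp_nil]
      by_cases hc : a = c
      · subst hc
        rw [vertex, ofPath_mul_comp, Quiver.Path.nil_comp]
        exact Submodule.subset_span ⟨p, rfl⟩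
      · rw [vertex, ofPath_mul_of_ne k _ _ hc]
        exact Submodule.zero_mem _
    · rw [vertex, ofPath_mul_of_ne k _ _ hd, zero_mul]
      exact Submodule.zero_mem _

/-- The image of `e_a` lies in `e_b A e_a`: on the left because it is in `P_b`, on the right because
`e_a` is idempotent. So paths bound `Hom(P_a, P_b)`. -/
lemma apply_projGen_mem_span {a b : V} (f : projObj k a ⟶ projObj k b) :
    (f.hom.hom (projGen k a)).1 ∈
      Submodule.span k (Set.range fun p : Quiver.Path a b ↦ ofPath k p) := by
  have h1 : (f.hom.hom (projGen k a)).1 =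
      vertex k b * (f.hom.hom (projGen k a)).1 * vertex k a := by
    rw [(f.hom.hom (projGen k a)).2]
    exact congrArg Subtype.val (apply_eq_op_smul k f (projGen k a))
  rw [h1]
  exact vertex_mul_mul_vertex_mem_span k a b _

lemma projObj_hom_eq_zero_of_isEmpty {a b : V} [IsEmpty (Quiver.Path a b)]
    (f : projObj k a ⟶ projObj k b) : f = 0 := by
  have h := apply_projGen_mem_span k f
  rw [Set.range_eq_empty, Submodule.span_empty, Submodule.mem_bot] at h
  exact projObj_hom_ext k (Subtype.ext h)

lemma projObj_end_eq_smul_id {a : V} [Subsingleton (Quiver.Path a a)]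
    (f : projObj k a ⟶ projObj k a) : ∃ c : k, f = c • 𝟙 _ := by
  have h := apply_projGen_mem_span k f
  have hr : (Set.range fun p : Quiver.Path a a ↦ ofPath k p) = {vertex k a} := by
    ext x
    exact ⟨fun ⟨p, hp⟩ ↦ hp ▸ congrArg (ofPath k) (Subsingleton.elim p Quiver.Path.nil),
      fun hx ↦ ⟨Quiver.Path.nil, hx.symm⟩⟩
  rw [hr, Submodule.mem_span_singleton] at h
  obtain ⟨c, hc⟩ := h
  refine ⟨c, projObj_hom_ext k (Subtype.ext ?_)⟩
  rw [← hc]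
  -- A scalar acts on a right module through right multiplication by its image in the algebra.
  change c • vertex k a = vertex k a * (algebraMap k (PathAlgebra k V) c)
  rw [Algebra.algebraMap_eq_smul_one, mul_smul', mul_one]

lemma ofPath_ne_zero {a b : V} (p : Quiver.Path a b) : ofPath k p ≠ 0 :=
  Finsupp.single_ne_zero.2 one_ne_zero

lemma id_projObj_ne_zero (a : V) : 𝟙 (projObj k a) ≠ 0 := fun h ↦
  ofPath_ne_zero k _ (congrArg (fun f : projObj k a ⟶ projObj k a ↦
    (f.hom.hom (projGen k a)).1) h)

lemma arrow_mul_injective {a b : V} (f : a ⟶ b) {x : PathAlgebra k V}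
    (hx : vertex k a * x = x) (h : arrow k f * x = 0) : x = 0 := by
  classical
  -- Deleting a final arrow `f` is a left inverse of appending it. Paths not ending in `f` go to
  -- zero.
  let φ : PathAlgebra k V →ₗ[k] PathAlgebra k V :=
    lift k fun p ↦ if hp : ∃ q : Quiver.Path p.1 a, p = ⟨p.1, b, q.cons f⟩ then
      ofPath k hp.choose else 0
  have hφ : ∀ {c : V} (q : Quiver.Path c a), φ (ofPath k (q.cons f)) = ofPath k q := by
    intro c q
    have hp : ∃ q' : Quiver.Path c a,
        (⟨c, b, q.cons f⟩ : Σ a b : V, Quiver.Path a b) = ⟨c, b, q'.cons f⟩ := ⟨q, rfl⟩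
    have h1 : ∀ q' : Quiver.Path c a,
        (⟨c, b, q.cons f⟩ : Σ a b : V, Quiver.Path a b) = ⟨c, b, q'.cons f⟩ → q' = q := by
      intro q' h2
      simp only [Sigma.mk.injEq, heq_eq_eq, true_and] at h2
      exact (eq_of_heq (Quiver.Path.heq_of_cons_eq_cons h2)).symm
    change lift k _ _ = _
    rw [lift_ofPath, dif_pos hp]
    exact congrArg (ofPath k) (h1 _ hp.choose_spec)
  have key : ∀ y : PathAlgebra k V, φ (arrow k f * (vertex k a * y)) = vertex k a * y := by
    intro y
    induction y using induction_paths with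
    | zero => simp
    | add x y hx hy => rw [mul_add, mul_add, map_add, hx, hy]
    | smul_path r c d p =>
      rw [mul_smul', mul_smul', map_smul]
      congr 1
      by_cases hd : d = a
      · subst hd
        rw [vertex, ofPath_mul_comp, Quiver.Path.comp_nil, arrow, ofPath_mul_comp]
        exact hφ p
      · rw [vertex, ofPath_mul_of_ne k _ _ hd, mul_zero, map_zero]
  rw [← hx, ← key x, hx, h, map_zero]

lemma eq_zero_of_comp_projMap {a b : V} (f : a ⟶ b) {M : RightMod.{u} (PathAlgebra k V)}
    (g : M ⟶ projObj k a)
    (h : g ≫ (FGModuleCat.ofHom (projMap k f) : projObj k a ⟶ projObj k b) = 0) : g = 0 := by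
  refine FGModuleCat.hom_ext (LinearMap.ext fun x ↦ Subtype.ext ?_)
  exact arrow_mul_injective k f (g.hom.hom x).2
    (congrArg (fun φ : M ⟶ projObj k b ↦ (φ.hom.hom x).1) h)

/-- Stripping the last arrow from each path in `g(e_c)` gives an element `y`. The condition `y e_c =
y` is needed because `projDesc` sends `e_c` to `y e_c`. -/
lemma exists_comp_projMap {a b c : V} (f : a ⟶ b)
    (hf : ∀ p : Quiver.Path c b, ∃ q : Quiver.Path c a, p = q.cons f)
    (g : projObj k c ⟶ projObj k b) :
    ∃ g' : projObj k c ⟶ projObj k a,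
      g = g' ≫ (FGModuleCat.ofHom (projMap k f) : projObj k a ⟶ projObj k b) := by
  have h := apply_projGen_mem_span k g
  have key : ∀ x ∈ Submodule.span k (Set.range fun p : Quiver.Path c b ↦ ofPath k p),
      ∃ y : PathAlgebra k V, vertex k a * y = y ∧ y * vertex k c = y ∧ arrow k f * y = x := by
    intro x hx
    induction hx using Submodule.span_induction with
    | mem x hx =>
      obtain ⟨p, rfl⟩ := hx
      obtain ⟨q, rfl⟩ := hf p
      refine ⟨ofPath k q, ?_, ?_, ?_⟩
      · rw [vertex, ofPath_mul_comp, Quiver.Path.comp_nil]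
      · rw [vertex, ofPath_mul_comp, Quiver.Path.nil_comp]
      · rw [arrow, ofPath_mul_comp]
        rfl
    | zero => exact ⟨0, mul_zero _, zero_mul _, mul_zero _⟩
    | add x x' _ _ hx hx' =>
      obtain ⟨y, h1, h2, h3⟩ := hx
      obtain ⟨y', h1', h2', h3'⟩ := hx'
      exact ⟨y + y', by rw [mul_add, h1, h1'], by rw [add_mul, h2, h2'], by rw [mul_add, h3, h3']⟩
    | smul r x _ hx =>
      obtain ⟨y, h1, h2, h3⟩ := hx
      exact ⟨r • y, by rw [mul_smul', h1], by rw [smul_mul', h2], by rw [mul_smul', h3]⟩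
  obtain ⟨y, h1, h2, h3⟩ := key _ h
  refine ⟨projDesc k c (M := projObj k a) ⟨y, h1⟩, projObj_hom_ext k (Subtype.ext ?_)⟩
  change _ = arrow k f * (y * vertex k c)
  rw [h2, h3]

end PathAlgebra

/-! ### Paths in the quivers of type `A_n` -/

namespace GammaQuiver

variable {n : ℕ} {J : Finset ℕ}

lemma index_injective {a b : GammaQuiver n J} (h : a.index = b.index) : a = b :=
  Fin.ext (Nat.add_right_cancel h)

/-- Each edge carries a single arrow, so a path cannot turn back, and all edges it crosses have the
same orientation. -/
lemma path_orientation {a b : GammaQuiver n J} (p : Quiver.Path a b) :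
    (a.index ≤ b.index ∧ ∀ i, a.index < i → i ≤ b.index → i ∉ J) ∨
      (b.index ≤ a.index ∧ ∀ i, b.index < i → i ≤ a.index → i ∈ J) := by
  induction p with
  | nil => exact Or.inl ⟨le_rfl, fun i h h' ↦ by omega⟩
  | @cons c b p f ih =>
    rcases f.down with ⟨hf, ho⟩ | ⟨hf, ho⟩
    · have hJ : b.index ∉ J := fun h ↦ by rw [orientation, if_pos h] at ho; omega
      rcases ih with ⟨h1, h2⟩ | ⟨h1, h2⟩
      · refine Or.inl ⟨by omega, fun i hi hi' ↦ ?_⟩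
        by_cases hib : i = b.index
        · rwa [hib]
        · exact h2 i hi (by omega)
      · rcases h1.eq_or_lt with h3 | h3
        · refine Or.inl ⟨by omega, fun i hi hi' ↦ ?_⟩
          rwa [show i = b.index by omega]
        · exact absurd (h2 b.index (by omega) (by omega)) hJ
    · have hJ : c.index ∈ J := by
        by_contra h
        rw [orientation, if_neg h] at ho
        omega
      rcases ih with ⟨h1, h2⟩ | ⟨h1, h2⟩
      · rcases h1.eq_or_lt with h3 | h3
        · refine Or.inr ⟨by omega, fun i hi hi' ↦ ?_⟩
          rwa [show i = c.index by omega]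
        · exact absurd hJ (h2 c.index h3 le_rfl)
      · refine Or.inr ⟨by omega, fun i hi hi' ↦ ?_⟩
        by_cases hic : i = c.index
        · rwa [hic]
        · exact h2 i (by omega) hi'

lemma arrow_orientation {a b : GammaQuiver n J} (f : a ⟶ b) :
    (b.index = a.index + 1 ∧ b.index ∉ J) ∨ (a.index = b.index + 1 ∧ a.index ∈ J) := by
  rcases f.down with ⟨hf, ho⟩ | ⟨hf, ho⟩
  · exact Or.inl ⟨hf, fun h ↦ by rw [orientation, if_pos h] at ho; omega⟩
  · refine Or.inr ⟨hf, ?_⟩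
    by_contra h
    rw [orientation, if_neg h] at ho
    omega

/-- The last arrows of two paths with the same endpoints start at the same vertex. -/
lemma eq_of_path_of_arrow {a b c d : GammaQuiver n J} (p : Quiver.Path a c) (f : c ⟶ b)
    (q : Quiver.Path a d) (g : d ⟶ b) : c = d := by
  -- Arrows into `b` from both sides mean `e_b ∉ J` and `e_{b+1} ∈ J`. A start `a ≤ b` cannot reach
  -- `d` and a start `a > b` cannot reach `c`, as either path crosses one of these edges backwards.
  have key : ∀ {c d : GammaQuiver n J}, Quiver.Path a c → Quiver.Path a d →
      b.index = c.index + 1 → b.index ∉ J → d.index = b.index + 1 → d.index ∈ J → False := by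
    intro c d p q h1 h2 h3 h4
    rcases path_orientation q with ⟨h5, h6⟩ | ⟨h5, h6⟩
    · by_cases h7 : a.index = d.index
      · rcases path_orientation p with ⟨h8, -⟩ | ⟨-, h9⟩
        · omega
        · exact h2 (h9 b.index (by omega) (by omega))
      · exact h6 d.index (by omega) le_rfl h4
    · rcases path_orientation p with ⟨h8, -⟩ | ⟨-, h9⟩
      · omega
      · exact h2 (h9 b.index (by omega) (by omega))
  rcases arrow_orientation f with ⟨h1, h2⟩ | ⟨h1, h2⟩ <;>
    rcases arrow_orientation g with ⟨h3, h4⟩ | ⟨h3, h4⟩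
  · exact index_injective (by omega)
  · exact (key p q h1 h2 h3 h4).elim
  · exact (key q p h3 h4 h1 h2).elim
  · exact index_injective (by omega)

instance (a b : GammaQuiver n J) : Subsingleton (a ⟶ b) := ⟨fun ⟨_⟩ ⟨_⟩ ↦ rfl⟩

/-- The height fixes the length of a path from its endpoints, and `eq_of_path_of_arrow` fixes its
last arrow; induction does the rest. -/
instance (a b : GammaQuiver n J) : Subsingleton (Quiver.Path a b) where
  allEq p q := by
    induction p with
    | nil =>
      refine (Quiver.Path.eq_nil_of_length_zero q ?_).symm
      have := height_path q
      omega
    | cons p f ih =>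
      cases q with
      | nil =>
        refine Quiver.Path.eq_nil_of_length_zero _ ?_
        have := height_path (p.cons f)
        omega
      | cons q g =>
        obtain rfl := eq_of_path_of_arrow p f q g
        rw [ih q, Subsingleton.elim f g]

lemma isEmpty_path_of_lt {a b : GammaQuiver n J} {i : ℕ} (h : a.index < i) (h' : i ≤ b.index)
    (hi : i ∈ J) : IsEmpty (Quiver.Path a b) := by
  refine ⟨fun p ↦ ?_⟩
  rcases path_orientation p with ⟨-, h2⟩ | ⟨h1, -⟩
  · exact h2 i h h' hi
  · omega

lemma isEmpty_path_of_gt {a b : GammaQuiver n J} {i : ℕ} (h : b.index < i) (h' : i ≤ a.index)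
    (hi : i ∉ J) : IsEmpty (Quiver.Path a b) := by
  refine ⟨fun p ↦ ?_⟩
  rcases path_orientation p with ⟨h1, -⟩ | ⟨-, h2⟩
  · omega
  · exact hi (h2 i h h')

/-- A path to `b` from a vertex on the right of `b` ends with the arrow from the right neighbour
of `b`. -/
lemma exists_eq_cons {a b c : GammaQuiver n J} (f : c ⟶ b) (hf : c.index = b.index + 1)
    (h : c.index ≤ a.index) (p : Quiver.Path a b) : ∃ q : Quiver.Path a c, p = q.cons f := by
  cases p with
  | nil => omega
  | @cons d _ q g =>
    suffices d = c by
      subst this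
      exact ⟨q, by rw [Subsingleton.elim f g]⟩
    rcases arrow_orientation g with ⟨h1, h2⟩ | ⟨h1, -⟩
    · exfalso
      rcases path_orientation q with ⟨h3, -⟩ | ⟨-, h4⟩
      · omega
      · exact h2 (h4 b.index (by omega) (by omega))
    · exact index_injective (by omega)

end GammaQuiver

/-! ### Jumps of the perversity -/

lemma perversity_succ (J : Finset ℕ) (j : ℕ) :
    perversity J (j + 2) = perversity J (j + 1) + if j + 2 ∈ J then 1 else 0 := by
  rw [perversity_eq_card J (j + 2) (by omega), perversity_eq_card J (j + 1) (by omega)]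
  split_ifs with h
  · have : (J.filter fun i ↦ 2 ≤ i ∧ i ≤ j + 2) =
        insert (j + 2) (J.filter fun i ↦ 2 ≤ i ∧ i ≤ j + 1) := by
      ext i
      simp only [Finset.mem_filter, Finset.mem_insert]
      constructor
      · rintro ⟨h1, h2, h3⟩
        by_cases hi : i = j + 2
        · exact Or.inl hi
        · exact Or.inr ⟨h1, h2, by omega⟩
      · rintro (rfl | ⟨h1, h2, h3⟩)
        · exact ⟨h, by omega, le_rfl⟩
        · exact ⟨h1, h2, by omega⟩
    rw [this, Finset.card_insert_of_notMem (by simp)]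
    push_cast
    ring
  · have : (J.filter fun i ↦ 2 ≤ i ∧ i ≤ j + 2) = (J.filter fun i ↦ 2 ≤ i ∧ i ≤ j + 1) := by
      refine Finset.filter_congr fun i hi ↦ ⟨fun h1 ↦ ⟨h1.1, ?_⟩, fun h1 ↦ ⟨h1.1, by omega⟩⟩
      have : i ≠ j + 2 := fun h2 ↦ h (h2 ▸ hi)
      omega
    rw [this, add_zero]

lemma perversity_eq_of_forall_notMem (J : Finset ℕ) {a b : ℕ} (hab : a ≤ b)
    (h : ∀ i, a + 1 < i → i ≤ b + 1 → i ∉ J) : perversity J (b + 1) = perversity J (a + 1) := by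
  induction b, hab using Nat.le_induction with
  | base => rfl
  | succ b hab ih =>
    rw [perversity_succ, ih fun i hi hi' ↦ h i hi (by omega),
      if_neg (h (b + 2) (by omega) (by omega)), add_zero]

/-! ### Perverse collections attached to systems of projective objects -/

section PerverseCollection

variable {D : Type u} [Category.{v} D] [Preadditive D] [HasZeroObject D] [HasShift D ℤ]
  [∀ m : ℤ, (shiftFunctor D m).Additive] [Pretriangulated D]
  (k : Type w) [Field k] [Linear k D] {n : ℕ} (J : Finset ℕ)

open Pretriangulated

section

variable {X Y Z : D} {f : X ⟶ Y} {g : Y ⟶ Z} {h : Z ⟶ X⟦(1 : ℤ)⟧}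

lemma mk_comp_eq_zero₁₂ (hT : Triangle.mk f g h ∈ distTriang D) : f ≫ g = 0 :=
  comp_distTriang_mor_zero₁₂ _ hT

lemma mk_comp_eq_zero₃₁ (hT : Triangle.mk f g h ∈ distTriang D) : h ≫ f⟦(1 : ℤ)⟧' = 0 :=
  comp_distTriang_mor_zero₃₁ _ hT

lemma mk_coyoneda_exact₂ (hT : Triangle.mk f g h ∈ distTriang D) {W : D} (x : W ⟶ Y)
    (hx : x ≫ g = 0) : ∃ y : W ⟶ X, x = y ≫ f :=
  Triangle.coyoneda_exact₂ _ hT x hx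

lemma mk_coyoneda_exact₃ (hT : Triangle.mk f g h ∈ distTriang D) {W : D} (x : W ⟶ Z)
    (hx : x ≫ h = 0) : ∃ y : W ⟶ Y, x = y ≫ g :=
  Triangle.coyoneda_exact₃ _ hT x hx

lemma mk_coyoneda_shift_exact₃ (hT : Triangle.mk f g h ∈ distTriang D) {W : D} (m : ℤ)
    (x : W ⟶ Z⟦m⟧) (hx : x ≫ h⟦m⟧' = 0) : ∃ y : W ⟶ Y⟦m⟧, x = y ≫ g⟦m⟧' :=
  coyoneda_shift_exact₃ hT m x hx

lemma mk_yoneda_exact₃ (hT : Triangle.mk f g h ∈ distTriang D) {W : D} (x : Z ⟶ W)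
    (hx : g ≫ x = 0) : ∃ y : X⟦(1 : ℤ)⟧ ⟶ W, x = h ≫ y :=
  Triangle.yoneda_exact₃ _ hT x hx

end

omit [HasZeroObject D] [Pretriangulated D] in
lemma finite_shift_hom [∀ m : ℤ, (shiftFunctor D m).Linear k] {P : D}
    (hP : ∀ X, Module.Finite k (P ⟶ X)) (a : ℤ) (X : D) : Module.Finite k (P⟦a⟧ ⟶ X) := by
  have := hP (X⟦-a⟧)
  have : Module.Finite k (P⟦a⟧ ⟶ X⟦-a⟧⟦a⟧) :=
    Module.Finite.of_surjective ((shiftFunctor D a).mapLinearMap k)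
      (shiftFunctor D a).map_surjective
  exact finite_hom_of_iso k (Iso.refl _) (shiftNegShift X a) this

omit [HasZeroObject D] [Pretriangulated D] in
lemma HomFiniteBounded.shift [∀ m : ℤ, (shiftFunctor D m).Linear k] {P : D}
    (hP : HomFiniteBounded k P) (a : ℤ) : HomFiniteBounded k (P⟦a⟧) where
  finite := finite_shift_hom k hP.finite a
  bounded X := by
    obtain ⟨N, hN⟩ := hP.bounded X
    refine ⟨N + a.natAbs, fun m hm ↦
      (homVanishes_shift_left_iff a m (m - a) (by omega)).2 (hN _ ?_)⟩
    rcases abs_cases m with h | h <;> rcases abs_cases (m - a) with h' | h' <;> omega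

omit [HasZeroObject D] [HasShift D ℤ] [∀ m : ℤ, (shiftFunctor D m).Additive]
  [Pretriangulated D] in
lemma bijective_smul_id_iff (X : D) : (Function.Bijective fun c : k ↦ c • 𝟙 X) ↔
    𝟙 X ≠ 0 ∧ ∀ f : X ⟶ X, ∃ c : k, f = c • 𝟙 X := by
  constructor
  · rintro ⟨h1, h2⟩
    refine ⟨fun h ↦ one_ne_zero (α := k) (h1 ?_), fun f ↦ (h2 f).imp fun _ h ↦ h.symm⟩
    simp [h]
  · rintro ⟨h1, h2⟩
    exact ⟨smul_left_injective k h1, fun f ↦ (h2 f).imp fun _ h ↦ h.symm⟩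

omit [HasZeroObject D] [Pretriangulated D] in
lemma bijective_smul_id_shift [∀ m : ℤ, (shiftFunctor D m).Linear k] {X : D}
    (h : Function.Bijective fun c : k ↦ c • 𝟙 X) (a : ℤ) :
    Function.Bijective fun c : k ↦ c • 𝟙 (X⟦a⟧) := by
  rw [bijective_smul_id_iff] at *
  refine ⟨fun h' ↦ h.1 ((shiftFunctor D a).map_injective ?_), fun f ↦ ?_⟩
  · rw [CategoryTheory.Functor.map_id, h', Functor.map_zero]
  · obtain ⟨g, rfl⟩ := (shiftFunctor D a).map_surjective f
    obtain ⟨c, rfl⟩ := h.2 g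
    exact ⟨c, by rw [Functor.map_smul, CategoryTheory.Functor.map_id]⟩

/-- The objects `P_1, …, P_n` behave like the indecomposable projective modules over the path
algebra of `Γ_J`, and `M_i` is the cone of `P_{i+1} ⟶ P_i` if there is such an arrow, and `P_i`
otherwise. (The vertex `v_{i+1}` has the index `i : Fin n`.) -/
structure IsGammaSystem (P M : Fin n → D) : Prop where
  homFiniteBounded (i : Fin n) : HomFiniteBounded k (P i)
  isZero (X : D) (h : ∀ i m, HomVanishes (P i) X m) : IsZero X
  homVanishes (i j : Fin n) (m : ℤ) (hm : m ≠ 0) : HomVanishes (P i) (P j) m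
  -- Here and in the next field `e_s` is an edge between the two vertices that points the wrong way.
  eq_zero_of_lt (i j : Fin n) (s : ℕ) (hi : i.val + 1 < s) (hj : s ≤ j.val + 1) (hs : s ∈ J)
    (f : P i ⟶ P j) : f = 0
  eq_zero_of_gt (i j : Fin n) (s : ℕ) (hj : j.val + 1 < s) (hi : s ≤ i.val + 1) (hs : s ∉ J)
    (f : P i ⟶ P j) : f = 0
  bijective_smul_id (i : Fin n) : Function.Bijective fun c : k ↦ c • 𝟙 (P i)
  exists_triangle (i : Fin n) (hi : i.val + 1 < n) (hJ : i.val + 2 ∈ J) :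
    ∃ (π : P ⟨i.val + 1, hi⟩ ⟶ P i) (ρ : P i ⟶ M i) (δ : M i ⟶ (P ⟨i.val + 1, hi⟩)⟦(1 : ℤ)⟧),
      Triangle.mk π ρ δ ∈ distTriang D ∧
      -- Composition with `π` is injective on maps from every `P_a`, and bijective when `a > i`.
      (∀ (a : Fin n) (g : P a ⟶ P ⟨i.val + 1, hi⟩), g ≫ π = 0 → g = 0) ∧
      ∀ a : Fin n, i < a → ∀ g : P a ⟶ P i, ∃ g', g = g' ≫ π
  nonempty_iso (i : Fin n) (h : i.val + 1 < n → i.val + 2 ∉ J) : Nonempty (P i ≅ M i)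

omit [HasZeroObject D] [Pretriangulated D] in
lemma homVanishes_iff_of_eq_shift {E M X : D} {a : ℤ} (hE : E = M⟦a⟧) (m : ℤ) :
    HomVanishes E X m ↔ HomVanishes M X (m - a) := by
  rw [hE, homVanishes_shift_left_iff a m (m - a) (by omega)]

/-! ### From the projectives to the collection -/

namespace IsGammaSystem

variable {k J} {P M : Fin n → D} (h : IsGammaSystem k J P M)

include h

/-- When `M_j` is a cone, only degrees 0 and -1 can contribute, as cokernel and kernel of
composition with `π`. The kernel is always zero. The cokernel is zero if `a > j`, and also if an
edge in `J` forces `Hom(P_a, P_j) = 0`. When `M_j = P_j` and `a > j`, the edge `e_{j+2}` blocks all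
maps. -/
lemma homVanishes_PM (a j : Fin n) (m : ℤ)
    (hm : m ≠ 0 ∨ j < a ∨ ∃ s ∈ J, a.val + 1 < s ∧ s ≤ j.val + 1) :
    HomVanishes (P a) (M j) m := by
  by_cases hj : j.val + 1 < n ∧ j.val + 2 ∈ J
  · obtain ⟨π, ρ, δ, hT, hπ, hπ'⟩ := h.exists_triangle j hj.1 hj.2
    by_cases h0 : m = 0
    · subst h0
      rw [homVanishes_zero_iff]
      intro f
      obtain ⟨g, rfl⟩ := mk_coyoneda_exact₃ hT f (h.homVanishes a _ 1 (by omega) _)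
      rcases hm with hm | hm | ⟨s, hs, has, hsj⟩
      · exact absurd rfl hm
      · obtain ⟨g', rfl⟩ := hπ' a hm g
        rw [Category.assoc, mk_comp_eq_zero₁₂ hT, comp_zero]
      · rw [h.eq_zero_of_lt a j s has hsj hs g, zero_comp]
    by_cases h1 : m = -1
    · subst h1
      -- Injectivity of composition with `π`, transported along `[1][-1] ≅ id`.
      have key : ∀ g : P a ⟶ (P ⟨j.val + 1, hj.1⟩)⟦(1 : ℤ)⟧⟦(-1 : ℤ)⟧,
          g ≫ π⟦(1 : ℤ)⟧'⟦(-1 : ℤ)⟧' = 0 → g = 0 := by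
        intro g hg
        have hnat : π⟦(1 : ℤ)⟧'⟦(-1 : ℤ)⟧' ≫ (shiftShiftNeg _ (1 : ℤ)).hom =
            (shiftShiftNeg _ (1 : ℤ)).hom ≫ π :=
          (shiftFunctorCompIsoId D (1 : ℤ) (-1) (by omega)).hom.naturality π
        have := hπ a (g ≫ (shiftShiftNeg _ (1 : ℤ)).hom) (by
          rw [Category.assoc, ← hnat, reassoc_of% hg, zero_comp])
        rwa [← cancel_mono (shiftShiftNeg _ (1 : ℤ)).hom, zero_comp]
      intro f
      obtain ⟨g, hg⟩ := mk_coyoneda_shift_exact₃ hT (-1) f (key _ (by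
        rw [Category.assoc, ← Functor.map_comp, mk_comp_eq_zero₃₁ hT, Functor.map_zero,
          comp_zero]))
      rw [hg, h.homVanishes a j (-1) (by omega) g, zero_comp]
    · exact HomVanishes.obj₃ hT m (m + 1) rfl (h.homVanishes a j m h0)
        (h.homVanishes a _ (m + 1) (by omega))
  · obtain ⟨e⟩ := h.nonempty_iso j fun h1 h2 ↦ hj ⟨h1, h2⟩
    refine HomVanishes.of_iso (Iso.refl _) e ?_
    by_cases h0 : m = 0
    · subst h0
      rw [homVanishes_zero_iff]
      rcases hm with hm | hm | ⟨s, hs, has, hsj⟩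
      · exact absurd rfl hm
      · rw [Fin.lt_def] at hm
        exact h.eq_zero_of_gt a j (j.val + 2) (by omega) (by omega)
          fun h2 ↦ hj ⟨by omega, h2⟩
      · exact h.eq_zero_of_lt a j s has hsj hs
    · exact h.homVanishes a j m h0

/-- In the one case that `homVanishes_PM` leaves open, no edge in `J` lies between the vertices, so
their perversities agree and the degree is `m` itself. -/
lemma homVanishes_PM_perversity (a j : Fin n) (m : ℤ) (hm : m ≠ 0 ∨ j < a) :
    HomVanishes (P a) (M j) (perversity J (j.val + 1) + m - perversity J (a.val + 1)) := by
  refine h.homVanishes_PM a j _ ?_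
  by_contra! hc
  have haj : ¬ j < a := not_lt.2 hc.2.1
  have := perversity_eq_of_forall_notMem J (a := a.val) (b := j.val) hc.2.1 fun s h1 h2 h3 ↦ by
    have := hc.2.2 s h3 h1
    omega
  exact hm.elim (fun hm ↦ hm (by omega)) haj

/-- The jump of the perversity at `e_{i+2} ∈ J` cancels the shift of `P_{i+2}` in the cone, so the
vanishing for both projectives is in the degrees needed for `M i`. -/
lemma homVanishes_MM_perversity (i j : Fin n) (m : ℤ) (hm : m ≠ 0 ∨ j < i) :
    HomVanishes (M i) (M j) (perversity J (j.val + 1) + m - perversity J (i.val + 1)) := by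
  by_cases hi : i.val + 1 < n ∧ i.val + 2 ∈ J
  · obtain ⟨π, ρ, δ, hT, -⟩ := h.exists_triangle i hi.1 hi.2
    have hp := perversity_succ J i.val
    rw [if_pos hi.2] at hp
    refine HomVanishes.src_obj₃ hT _ _ ?_ (h.homVanishes_PM_perversity ⟨i.val + 1, hi.1⟩ j m
      (hm.imp_right fun h ↦ h.trans (Fin.lt_def.2 (Nat.lt_succ_self _))))
      (h.homVanishes_PM_perversity i j m hm)
    change _ + m - perversity J (i.val + 2) + 1 = _
    omega
  · obtain ⟨e⟩ := h.nonempty_iso i fun h1 h2 ↦ hi ⟨h1, h2⟩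
    exact (h.homVanishes_PM_perversity i j m hm).of_iso e (Iso.refl _)

lemma bijective_smul_id_M (i : Fin n) : Function.Bijective fun c : k ↦ c • 𝟙 (M i) := by
  have hP := (bijective_smul_id_iff k _).1 (h.bijective_smul_id i)
  rw [bijective_smul_id_iff]
  by_cases hi : i.val + 1 < n ∧ i.val + 2 ∈ J
  · obtain ⟨π, ρ, δ, hT, -⟩ := h.exists_triangle i hi.1 hi.2
    have hPP : ∀ g : P i ⟶ P ⟨i.val + 1, hi.1⟩, g = 0 :=
      h.eq_zero_of_lt i _ (i.val + 2) (by omega) le_rfl hi.2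
    refine ⟨fun h0 ↦ hP.1 ?_, fun f ↦ ?_⟩
    · have hρ : ρ = 0 := by rw [← Category.comp_id ρ, h0, comp_zero]
      obtain ⟨g, hg⟩ := mk_coyoneda_exact₂ hT (𝟙 (P i))
        ((Category.id_comp _).trans hρ)
      rw [hg, hPP g, zero_comp]
    · obtain ⟨g, hg⟩ := mk_coyoneda_exact₃ hT (ρ ≫ f)
        (h.homVanishes i _ 1 (by omega) _)
      obtain ⟨c, rfl⟩ := hP.2 g
      refine ⟨c, ?_⟩
      -- An endomorphism of the cone is determined by its restriction along `ρ`, since the shifted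
      -- source of `π` has no map to `M i`.
      obtain ⟨s, hs⟩ := mk_yoneda_exact₃ hT (f - c • 𝟙 (M i)) (by
        rw [Preadditive.comp_sub, hg, Linear.smul_comp, Linear.comp_smul, Category.comp_id,
          Category.id_comp, sub_self])
      have hs0 : s = 0 := (hom_shift_eq_zero_iff 1).2
        (h.homVanishes_PM ⟨i.val + 1, hi.1⟩ i (-1) (Or.inl (by omega))) s
      rw [← sub_eq_zero, hs, hs0, comp_zero]
  · obtain ⟨e⟩ := h.nonempty_iso i fun h1 h2 ↦ hi ⟨h1, h2⟩
    refine ⟨fun h0 ↦ hP.1 ?_, fun f ↦ ?_⟩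
    · rw [← cancel_mono e.hom, Category.id_comp, zero_comp, ← Category.comp_id e.hom, h0,
        comp_zero]
    · obtain ⟨c, hc⟩ := hP.2 (e.hom ≫ f ≫ e.inv)
      refine ⟨c, ?_⟩
      rw [← cancel_epi e.hom, ← cancel_mono e.inv, Category.assoc, hc]
      simp

lemma homFiniteBounded_M [∀ m : ℤ, (shiftFunctor D m).Linear k] (i : Fin n) :
    HomFiniteBounded k (M i) := by
  by_cases hi : i.val + 1 < n ∧ i.val + 2 ∈ J
  · obtain ⟨π, ρ, δ, hT, -⟩ := h.exists_triangle i hi.1 hi.2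
    have h1 := h.homFiniteBounded i
    have h2 := (h.homFiniteBounded ⟨i.val + 1, hi.1⟩).shift k 1
    refine ⟨fun X ↦ finite_hom_src_obj₂ k (rot_of_distTriang _ hT) (h1.finite X) (h2.finite X),
      fun X ↦ ?_⟩
    obtain ⟨N₁, hN₁⟩ := h1.bounded X
    obtain ⟨N₂, hN₂⟩ := h2.bounded X
    exact ⟨max N₁ N₂, fun m hm ↦ HomVanishes.src_obj₂ (rot_of_distTriang _ hT)
      (hN₁ m (by omega)) (hN₂ m (by omega))⟩
  · obtain ⟨e⟩ := h.nonempty_iso i fun h1 h2 ↦ hi ⟨h1, h2⟩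
    exact ⟨fun X ↦ finite_hom_of_iso k e (Iso.refl X) ((h.homFiniteBounded i).finite X),
      fun X ↦ ((h.homFiniteBounded i).bounded X).imp
        fun N hN m hm ↦ (hN m hm).of_iso e (Iso.refl X)⟩

/-- Descending induction on `i`: `P i` is an extension of `M i` and the next projective. The
inclusions between the degree sets let the induction hypothesis apply. -/
lemma homVanishes_P_of_M (S : ℕ → Set ℤ) (hS : ∀ i, i + 2 ∈ J → S i ⊆ S (i + 1)) {X : D}
    (hX : ∀ i : Fin n, ∀ l ∈ S i, HomVanishes (M i) X l) (i : Fin n) :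
    ∀ l ∈ S i, HomVanishes (P i) X l := by
  obtain ⟨d, hd⟩ : ∃ d, d = n - i.val := ⟨_, rfl⟩
  induction d generalizing i with
  | zero => have := i.isLt; omega
  | succ d ih =>
    intro l hl
    by_cases hi : i.val + 1 < n ∧ i.val + 2 ∈ J
    · obtain ⟨π, ρ, δ, hT, -⟩ := h.exists_triangle i hi.1 hi.2
      exact HomVanishes.src_obj₂ hT (ih ⟨i.val + 1, hi.1⟩ (by rw [Fin.val_mk]; omega) l
        (hS i.val hi.2 hl)) (hX i l hl)
    · obtain ⟨e⟩ := h.nonempty_iso i fun h1 h2 ↦ hi ⟨h1, h2⟩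
      exact (hX i l hl).of_iso e.symm (Iso.refl _)

variable {E : Fin n → D} (hE : ∀ i, E i = (M i)⟦perversity J (i.val + 1)⟧)

include hE

lemma homVanishes_EE (i j : Fin n) (m : ℤ) (hm : m ≠ 0 ∨ j < i) : HomVanishes (E i) (E j) m := by
  rw [homVanishes_iff_of_eq_shift (hE i), hE j, homVanishes_shift_right_iff _ _ _ rfl]
  convert h.homVanishes_MM_perversity i j m hm using 1
  omega

lemma isExceptionalCollection [∀ m : ℤ, (shiftFunctor D m).Linear k] :
    IsExceptionalCollection k E where
  bijective_smul_id i := by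
    rw [hE]
    exact bijective_smul_id_shift k (h.bijective_smul_id_M i) _
  self_eq_zero i m hm := h.homVanishes_EE hE i i m (Or.inl hm)
  eq_zero_of_lt i j hij m := h.homVanishes_EE hE j i m (Or.inr hij)

lemma isStrongCollection : IsStrongCollection E := fun i j m hm ↦
  h.homVanishes_EE hE i j m (Or.inl hm)

lemma homFiniteBounded_E [∀ m : ℤ, (shiftFunctor D m).Linear k] (i : Fin n) :
    HomFiniteBounded k (E i) := by
  rw [hE]
  exact (h.homFiniteBounded_M i).shift k _

lemma isZero_of_homVanishes_E (X : D) (hX : ∀ i m, HomVanishes (E i) X m) : IsZero X :=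
  h.isZero X fun i m ↦ h.homVanishes_P_of_M (fun _ ↦ Set.univ) (fun _ _ ↦ subset_rfl)
    (fun i l _ ↦ by
      have := (homVanishes_iff_of_eq_shift (X := X) (hE i) (l + perversity J (i.val + 1))).1 (hX _ _)
      rwa [add_sub_cancel_right] at this) i m trivial

/-- The range `l > -p_J` grows by one degree at an edge in `J`. This suits both directions: the
extension of `M i` by the next projective needs degree `l` there, and the cone needs degree `l - 1`.
-/
lemma tiltLE_zero_iff (X : D) : tiltLE E 0 X ↔
    ∀ i : Fin n, ∀ l > -perversity J (i.val + 1), HomVanishes (P i) X l := by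
  have h1 : tiltLE E 0 X ↔
      ∀ i : Fin n, ∀ l > -perversity J (i.val + 1), HomVanishes (M i) X l := by
    refine forall_congr' fun i ↦ ⟨fun H l hl ↦ ?_, fun H m hm ↦
      (homVanishes_iff_of_eq_shift (hE i) m).2 (H _ (by omega))⟩
    have := (homVanishes_iff_of_eq_shift (X := X) (hE i) (l + perversity J (i.val + 1))).1 (H _ (by omega))
    rwa [add_sub_cancel_right] at this
  rw [h1]
  constructor
  · intro H i
    refine h.homVanishes_P_of_M (fun i ↦ {l | l > -perversity J (i + 1)}) (fun i hi l hl ↦ ?_)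
      H i
    have := perversity_succ J i
    rw [if_pos hi] at this
    change l > -perversity J (i + 2)
    change l > -perversity J (i + 1) at hl
    omega
  · intro H i l hl
    by_cases hi : i.val + 1 < n ∧ i.val + 2 ∈ J
    · obtain ⟨π, ρ, δ, hT, -⟩ := h.exists_triangle i hi.1 hi.2
      have hp := perversity_succ J i.val
      rw [if_pos hi.2] at hp
      exact HomVanishes.src_obj₃ hT (l - 1) l (by omega) (H ⟨i.val + 1, hi.1⟩ (l - 1) (by
        change l - 1 > -perversity J (i.val + 2)
        omega)) (H i l hl)
    · obtain ⟨e⟩ := h.nonempty_iso i fun h1 h2 ↦ hi ⟨h1, h2⟩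
      exact (H i l hl).of_iso e (Iso.refl _)

end IsGammaSystem

omit [Pretriangulated D] [HasZeroObject D] [HasShift D ℤ] [∀ m : ℤ, (shiftFunctor D m).Additive] in
lemma finite_biproduct_hom [HasFiniteBiproducts D] (E : Fin n → D) (X : D)
    (hE : ∀ i, Module.Finite k (E i ⟶ X)) : Module.Finite k (⨁ E ⟶ X) :=
  Module.Finite.of_injective (LinearMap.pi fun i ↦ Linear.leftComp k X (biproduct.ι E i))
    fun _ _ hfg ↦ biproduct.hom_ext' _ _ fun i ↦ congrFun hfg i

variable {k} in
lemma isTiltingTStructure_tilt [IsTriangulated D] {E : Fin n → D}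
    (hE : IsExceptionalCollection k E)
    (hs : IsStrongCollection E) (hfin : ∀ i, HomFiniteBounded k (E i))
    (hgen : ∀ X, (∀ i m, HomVanishes (E i) X m) → IsZero X) :
    IsTiltingTStructure (tiltTStructure hE hs hfin hgen) (⨁ E) where
  le_iff a X := by
    simp only [homVanishes_biproduct_left_iff]
    exact ⟨fun h m hm i ↦ h i m hm, fun h i m hm ↦ h m hm i⟩
  ge_iff a X := by
    simp only [homVanishes_biproduct_left_iff]
    exact ⟨fun h m hm i ↦ h i m hm, fun h i m hm ↦ h m hm i⟩
  self m hm := (homVanishes_biproduct_left_iff _ _ _).2 fun i ↦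
    homVanishes_biproduct_right _ _ _ fun j ↦ hs i j m hm

end PerverseCollection

/-! ### The bounded derived category -/

section BoundedDerived

open DerivedCategory Pretriangulated

variable {C : Type u} [Category.{v} C] [Abelian C] [HasDerivedCategory.{w} C]

lemma homVanishes_bounded_iff {P X : Bounded C} (m : ℤ) :
    HomVanishes P X m ↔ HomVanishes P.obj X.obj m := by
  constructor
  · intro h f
    have h1 := h (ObjectProperty.homMk (f ≫ ((Bounded.ι (C := C)).commShiftIso m).inv.app X))
    have h2 : f ≫ ((Bounded.ι (C := C)).commShiftIso m).inv.app X = 0 :=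
      congrArg (fun g ↦ (Bounded.ι (C := C)).map g) h1
    rwa [← cancel_mono (((Bounded.ι (C := C)).commShiftIso m).inv.app X), zero_comp]
  · intro h f
    apply (Bounded.ι (C := C)).map_injective
    rw [← cancel_mono (((Bounded.ι (C := C)).commShiftIso m).hom.app X), Functor.map_zero, zero_comp]
    exact h _

variable (k : Type*) [Field k] [Linear k C]

instance (m : ℤ) : (shiftFunctor (Bounded C) m).Linear k where
  map_smul {X Y} f c := by
    apply (Bounded.ι (C := C)).map_injective
    have h : ∀ g : X ⟶ Y, (Bounded.ι (C := C)).map (g⟦m⟧') ≫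
        ((Bounded.ι (C := C)).commShiftIso m).hom.app Y =
          ((Bounded.ι (C := C)).commShiftIso m).hom.app X ≫
            ((Bounded.ι (C := C)).map g)⟦m⟧' :=
      fun g ↦ ((Bounded.ι (C := C)).commShiftIso m).hom.naturality g
    rw [← cancel_mono (((Bounded.ι (C := C)).commShiftIso m).hom.app Y), h, Functor.map_smul,
      Functor.map_smul, Functor.map_smul, Linear.smul_comp, h, Linear.comp_smul]

lemma finite_hom_bounded {P X : Bounded C} (h : Module.Finite k (P.obj ⟶ X.obj)) :
    Module.Finite k (P ⟶ X) :=
  have : Module.Finite k ((Bounded.ι (C := C)).obj P ⟶ (Bounded.ι (C := C)).obj X) := h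
  Module.Finite.of_injective ((Bounded.ι (C := C)).mapLinearMap k)
    (Bounded.ι (C := C)).map_injective

lemma homFiniteBounded_of_single {P : C} [Projective P] (hP : ∀ M : C, Module.Finite k (P ⟶ M))
    {Y : Bounded C} (hY : Y.obj = (singleFunctor C 0).obj P) : HomFiniteBounded k Y where
  finite X := finite_hom_bounded k (hY ▸ finite_single_hom k P hP X.obj)
  bounded X := by
    obtain ⟨⟨a, ha⟩, ⟨b, hb⟩⟩ := X.property
    have : X.obj.IsGE a := ha
    have : X.obj.IsLE b := hb
    -- If `|m|` exceeds both `|a|` and `|b|`, then `m > b` or `m < a`, so `m` lies outside the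
    -- amplitude of `X`.
    refine ⟨max a.natAbs b.natAbs, fun m hm ↦ (homVanishes_bounded_iff m).2 ?_⟩
    rw [hY]
    by_cases hbm : b < m
    · exact homVanishes_single_of_isLE P X.obj b m hbm
    · refine homVanishes_single_of_isGE P X.obj a m ?_
      rcases abs_cases m with h | h <;> omega

lemma isZero_of_homVanishes_bounded {ι : Type*} (P : ι → C) [∀ i, Projective (P i)]
    (hP : ∀ M : C, (∀ (i : ι) (f : P i ⟶ M), f = 0) → IsZero M) {Y : ι → Bounded C}
    (hY : ∀ i, (Y i).obj = (singleFunctor C 0).obj (P i)) (X : Bounded C)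
    (hX : ∀ i m, HomVanishes (Y i) X m) : IsZero X := by
  obtain ⟨⟨a, ha⟩, ⟨b, hb⟩⟩ := X.property
  have : X.obj.IsGE a := ha
  have : X.obj.IsLE b := hb
  have h0 : IsZero X.obj := isZero_of_homVanishes_single P hP X.obj a b fun i m ↦
    hY i ▸ (homVanishes_bounded_iff m).1 (hX i m)
  rw [IsZero.iff_id_eq_zero]
  exact (Bounded.ι (C := C)).map_injective (h0.eq_of_src _ _)

end BoundedDerived

/-! ### The projective modules in the derived category of `Γ_J` -/

section GammaDerived

open DerivedCategory Pretriangulated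

variable (k : Type u) [Field k] (n : ℕ) (J : Finset ℕ)
  [HasDerivedCategory.{w} (RightMod.{u} (GammaAlgebra k n J))]

section

variable {k n J} {M N L : RightMod.{u} (GammaAlgebra k n J)}

/-- A map of modules, as a morphism in the bounded derived category. -/
noncomputable def toDerivedMap (f : M ⟶ N) : toDerived k n J M ⟶ toDerived k n J N :=
  ObjectProperty.homMk (Q.map ((CochainComplex.singleFunctor _ 0).map f))

lemma toDerivedMap_surjective (g : toDerived k n J M ⟶ toDerived k n J N) :
    ∃ f : M ⟶ N, g = toDerivedMap f := by
  obtain ⟨f, hf⟩ := (singleFunctor (RightMod.{u} (GammaAlgebra k n J)) 0).map_surjective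
    (X := M) (Y := N) g.hom
  exact ⟨f, ObjectProperty.hom_ext _ hf.symm⟩

lemma toDerivedMap_zero : toDerivedMap (0 : M ⟶ N) = 0 :=
  ObjectProperty.hom_ext _ ((singleFunctor _ 0).map_zero M N)

lemma toDerivedMap_injective {f g : M ⟶ N} (h : toDerivedMap f = toDerivedMap g) : f = g :=
  (singleFunctor _ 0).map_injective 
    (congrArg (fun φ : toDerived k n J M ⟶ toDerived k n J N ↦ φ.hom) h)

lemma toDerivedMap_comp (f : M ⟶ N) (g : N ⟶ L) :
    toDerivedMap (f ≫ g) = toDerivedMap f ≫ toDerivedMap g :=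
  ObjectProperty.hom_ext _ ((singleFunctor _ 0).map_comp f g)

lemma toDerivedMap_smul_id (c : k) :
    toDerivedMap (c • 𝟙 M) = c • 𝟙 (toDerived k n J M) :=
  ObjectProperty.hom_ext _ (((singleFunctor _ 0).map_smul c (𝟙 M)).trans
    (congrArg (c • ·) ((singleFunctor _ 0).map_id M)))

/-- Distinguished triangles of the bounded category are detected in the full derived category. Only
the third map must be corrected by the comparison of shifts. -/
lemma exists_coneDerived_triangle (φ : M ⟶ N) :
    ∃ (ρ : toDerived k n J N ⟶ coneDerived k n J φ)
      (δ : coneDerived k n J φ ⟶ (toDerived k n J M)⟦(1 : ℤ)⟧),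
      Triangle.mk (toDerivedMap φ) ρ δ ∈ distTriang _ := by
  let T := Q.mapTriangle.obj
    (CochainComplex.mappingCone.triangle ((CochainComplex.singleFunctor _ 0).map φ))
  let e := (Bounded.ι (C := RightMod.{u} (GammaAlgebra k n J))).commShiftIso (1 : ℤ)
  let ρ : toDerived k n J N ⟶ coneDerived k n J φ := ObjectProperty.homMk T.mor₂
  let δ : coneDerived k n J φ ⟶ (toDerived k n J M)⟦(1 : ℤ)⟧ :=
    ObjectProperty.homMk (T.mor₃ ≫ e.inv.app (toDerived k n J M))
  refine ⟨ρ, δ, ?_⟩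
  rw [← (Bounded.ι (C := RightMod.{u} (GammaAlgebra k n J))).map_distinguished_iff]
  refine isomorphic_distinguished T (mappingCone_triangle_distinguished _) _
    (Triangle.isoMk _ _ (Iso.refl _) (Iso.refl _) (Iso.refl _) ?_ ?_ ?_)
  · exact (Category.comp_id _).trans (Category.id_comp _).symm
  · exact (Category.comp_id _).trans (Category.id_comp _).symm
  · have h : (T.mor₃ ≫ e.inv.app (toDerived k n J M)) ≫ e.hom.app (toDerived k n J M) = T.mor₃ :=
      (Category.assoc _ _ _).trans ((congrArg (T.mor₃ ≫ ·)
        (e.inv_hom_id_app (toDerived k n J M))).trans (Category.comp_id _))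
    exact (congrArg (_ ≫ ·) ((shiftFunctor _ (1 : ℤ)).map_id _)).trans
      ((Category.comp_id _).trans (h.trans (Category.id_comp _).symm))

end

lemma homVanishes_toDerived {M N : RightMod.{u} (GammaAlgebra k n J)} [Projective M] (m : ℤ)
    (hm : m ≠ 0) : HomVanishes (toDerived k n J M) (toDerived k n J N) m := by
  rw [homVanishes_bounded_iff]
  rcases lt_or_gt_of_ne hm with h | h
  · exact homVanishes_single_of_isGE M ((singleFunctor _ 0).obj N) 0 m h
  · exact homVanishes_single_of_isLE M ((singleFunctor _ 0).obj N) 0 m h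

/-- The object `P_{i+1}` of the derived category. -/
noncomputable abbrev derivedProj (i : Fin n) : GammaDerived k n J :=
  toDerived k n J (gammaProj k n J i)

instance (i : Fin n) : Projective (gammaProj k n J i) :=
  inferInstanceAs (Projective (PathAlgebra.projObj k (GammaQuiver.vert J i)))

/-- The object `E_{i+1}` before the shift. -/
noncomputable def unshiftedE (i : Fin n) : GammaDerived k n J :=
  if h : i.val + 1 < n ∧ orientation J (i.val + 2) = -1 then
    coneDerived k n J (gammaProjMap k n J i h.1 h.2)
  else derivedProj k n J i

lemma collectionE_eq_shift (i : Fin n) :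
    collectionE k n J i = (unshiftedE k n J i)⟦perversity J (i.val + 1)⟧ := by
  rw [collectionE, unshiftedE]
  split_ifs <;> rfl

lemma orientation_eq_neg_one_iff (i : ℕ) : orientation J i = -1 ↔ i ∈ J := by
  rw [orientation]
  split_ifs with h <;> simp [h]

/-- Degree-0 maps between the `P_i` in the derived category are module maps, so the remaining
conditions become statements about paths. -/
lemma isGammaSystem_derivedProj :
    IsGammaSystem k J (derivedProj k n J) (unshiftedE k n J) where
  homFiniteBounded i := homFiniteBounded_of_single k (P := gammaProj k n J i)
    (Y := derivedProj k n J i)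
    (PathAlgebra.finite_projObj_hom k (GammaQuiver.vert J i)) rfl
  isZero X h := isZero_of_homVanishes_bounded (gammaProj k n J)
    (PathAlgebra.isZero_of_forall_projObj_hom (V := GammaQuiver n J) k) (fun _ ↦ rfl) X h
  homVanishes i j m hm := homVanishes_toDerived k n J m hm
  eq_zero_of_lt i j s hi hj hs f := by
    obtain ⟨f, rfl⟩ := toDerivedMap_surjective f
    have : IsEmpty (Quiver.Path (GammaQuiver.vert J i) (GammaQuiver.vert J j)) :=
      GammaQuiver.isEmpty_path_of_lt hi hj hs
    exact (congrArg toDerivedMap (PathAlgebra.projObj_hom_eq_zero_of_isEmpty k f)).trans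
      toDerivedMap_zero
  eq_zero_of_gt i j s hj hi hs f := by
    obtain ⟨f, rfl⟩ := toDerivedMap_surjective f
    have : IsEmpty (Quiver.Path (GammaQuiver.vert J i) (GammaQuiver.vert J j)) :=
      GammaQuiver.isEmpty_path_of_gt hj hi hs
    exact (congrArg toDerivedMap (PathAlgebra.projObj_hom_eq_zero_of_isEmpty k f)).trans
      toDerivedMap_zero
  bijective_smul_id i := by
    rw [bijective_smul_id_iff]
    refine ⟨fun h ↦ ?_, fun f ↦ ?_⟩
    · refine PathAlgebra.id_projObj_ne_zero k (GammaQuiver.vert J i)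
        (toDerivedMap_injective (M := gammaProj k n J i) (N := gammaProj k n J i) ?_)
      have := toDerivedMap_smul_id (M := gammaProj k n J i) (1 : k)
      rw [one_smul, one_smul] at this
      exact this.trans (h.trans toDerivedMap_zero.symm)
    · obtain ⟨f, rfl⟩ := toDerivedMap_surjective f
      obtain ⟨c, hc⟩ := PathAlgebra.projObj_end_eq_smul_id k (a := GammaQuiver.vert J i) f
      exact ⟨c, (congrArg toDerivedMap hc).trans (toDerivedMap_smul_id c)⟩
  exists_triangle i hi hJ := by
    have ho := (orientation_eq_neg_one_iff J (i.val + 2)).2 hJ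
    have hM : unshiftedE k n J i = coneDerived k n J (gammaProjMap k n J i hi ho) :=
      dif_pos ⟨hi, ho⟩
    rw [hM]
    obtain ⟨ρ, δ, hT⟩ := exists_coneDerived_triangle (gammaProjMap k n J i hi ho)
    refine ⟨_, ρ, δ, hT, fun a g hg ↦ ?_, fun a ha g ↦ ?_⟩
    · obtain ⟨g, rfl⟩ := toDerivedMap_surjective g
      rw [← toDerivedMap_comp, ← toDerivedMap_zero] at hg
      exact (congrArg toDerivedMap (PathAlgebra.eq_zero_of_comp_projMap k
        (GammaQuiver.leftArrow i hi ho) g (toDerivedMap_injective hg))).trans toDerivedMap_zero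
    · obtain ⟨g, rfl⟩ := toDerivedMap_surjective g
      obtain ⟨g', hg'⟩ := PathAlgebra.exists_comp_projMap k (c := GammaQuiver.vert J a)
        (GammaQuiver.leftArrow i hi ho)
        (GammaQuiver.exists_eq_cons (GammaQuiver.leftArrow i hi ho) rfl
          (Nat.succ_le_succ (Fin.lt_def.1 ha))) g
      exact ⟨toDerivedMap g', (congrArg toDerivedMap hg').trans (toDerivedMap_comp _ _)⟩
  nonempty_iso i h := by
    have : unshiftedE k n J i = derivedProj k n J i :=
      dif_neg fun h' ↦ h h'.1 ((orientation_eq_neg_one_iff J _).1 h'.2)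
    rw [this]
    exact ⟨Iso.refl _⟩

lemma perverseGE_iff (X : GammaDerived k n J) : perverseGE k n J X ↔
    ∀ i : Fin n, ∀ l > -perversity J (i.val + 1), HomVanishes (derivedProj k n J i) X l :=
  forall_congr' fun i ↦ ⟨fun h l hl ↦ by
    have := h (-l) (by omega)
    rwa [neg_neg] at this, fun h m hm ↦ h (-m) (by omega)⟩

end GammaDerived

/-! ### The main theorem -/

theorem mainTheorem4 (k : Type u) [Field k] (n : ℕ) (J : Finset ℕ) (hJ : J ⊆ Finset.Icc 2 n)
    [HasDerivedCategory.{w} (RightMod.{u} (GammaAlgebra k n J))] :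
    (IsExceptionalCollection k (collectionE k n J) ∧
      IsStrongCollection (collectionE k n J) ∧
      IsCompleteCollection (collectionE k n J)) ∧
    -- Mathlib's t-structures are cohomologically graded, so `t.le 0` is the half `𝓓^{≥ 0}_J`
    -- of the homological grading.
    ∃ t : TStructure (GammaDerived k n J),
      t.le 0 = perverseGE k n J ∧ t.ge 0 = perverseLE k n J ∧
      (∀ i, t.heart (collectionE k n J i)) ∧
      Nonempty (t.heart.FullSubcategory ≌
        RightMod.{w} (YonedaAlgebra (collectionE k n J))) := by
  have h := isGammaSystem_derivedProj k n J
  have hM := collectionE_eq_shift k n J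
  have hE := h.isExceptionalCollection hM
  have hs := h.isStrongCollection hM
  have hfin := h.homFiniteBounded_E hM
  have hgen := h.isZero_of_homVanishes_E hM
  refine ⟨⟨hE, hs, isCompleteCollection_of_generates hE hfin hgen⟩,
    tiltTStructure hE hs hfin hgen, ?_⟩
  have hle : (tiltTStructure hE hs hfin hgen).le 0 = perverseGE k n J := by
    ext X
    exact (h.tiltLE_zero_iff hM X).trans (perverseGE_iff k n J X).symm
  refine ⟨hle, ?_, fun i ↦ ⟨fun j m hm ↦ hs j i m hm.ne', fun j m hm ↦ hs j i m hm.ne⟩, ?_⟩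
  · ext X
    -- `perverseLE` is by definition the orthogonal that determines the upper half of a t-structure
    -- from its lower half.
    rw [ge_zero_iff_forall_hom_shift_eq_zero, hle]
    rfl
  · exact (isTiltingTStructure_tilt hE hs hfin hgen).nonempty_heart_equivalence k fun X ↦
      finite_biproduct_hom k _ X fun i ↦ (hfin i).finite X
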